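/- **Setting.** A model $\mathcal M=\{A,B,C,D\}$ with $A\in\mathbb C^{n\times n}$, $B\in\mathbb C^{n\times m}$, $C\in\mathbb C^{m\times n}$, $D\in\mathbb C^{m\times m}$, $m\ge 1$, is a realization of $\mathcal T(s)=C(sI-A)^{-1}B+D$. It is minimal if $(A,B)$ and $(A^{\mathsf H},C^{\mathsf H})$ are controllable. It is strictly passive if all eigenvalues of $A$ lie in the open left half plane, $\mathcal T(\imath\omega)^{\mathsf H}+\mathcal T(\imath\omega)>0$ for all real $\omega$, and $D^{\mathsf H}+D>0$; a transfer function is called strictly passive if its minimal realizations are. For Hermitian $X$ put $$W(X,\mathcal M)=\begin{bmatrix}-A^{\mathsf H}X-XA & C^{\mathsf H}-XB\\ C-B^{\mathsf H}X & D^{\mathsf H}+D\end{bmatrix}.$$ Let $\|\Delta\|$ be the spectral norm or the Frobenius norm of $\begin{bmatrix}\Delta_A&\Delta_B\\ \Delta_C&\Delta_D\end{bmatrix}$. For $X>0$ with $W(X,\mathcal M)>0$ let $$\rho_{\mathcal M}(X)=\inf\{\|\Delta\| : \det W(X,\mathcal M+\Delta)=0\},\qquad \rho_{\mathcal M}=\sup\{\rho_{\mathcal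 M}(X) : X>0,\ W(X,\mathcal M)>0\}$$ be the $X$-passivity radius and the passivity radius of $\mathcal M$ ($\rho_{\mathcal M}=0$ if there is no such $X$), and let $\delta_{\mathcal M}=\inf\{\|\Delta\| : \mathcal M+\Delta \text{ is not strictly passive}\}$. For real $\xi$ let $\mathcal M_\xi=\{A+\frac{\xi}{2}I,B,C,D-\frac{\xi}{2}I\}$, a realization of $\mathcal T_\xi(s)=C((s-\frac{\xi}{2})I-A)^{-1}B+D-\frac{\xi}{2}I$. A model is port-Hamiltonian with $Q=I$ if $A=J-R$, $B=G-K$, $C=(G+K)^{\mathsf H}$, $D=S+N$, where $\begin{bmatrix}J&G\\-G^{\mathsf H}&N\end{bmatrix}$ is skew-Hermitian and $\begin{bmatrix}R&K\\K^{\mathsf H}&S\end{bmatrix}$ is Hermitian positive semidefinite. For invertible $T$ let $\mathcal M_T=\{TAT^{-1},TB,CT^{-1},D\}$. **Theorem.** Let $\mathcal M$ be a minimal realization of a strictly passive transfer function $\mathcal T$, and let $\Xi=\sup\{\xi\in\mathbb R : \mathcal T_\xi \text{ is strictly passive}\}$. Then, for the spectral norm as well as for the Frobenius norm: 1. $0<\Xi<\infty$.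 2. $\Xi/2$ is the maximum of the passivity radii $\rho_{\mathcal M'}$ over all realizations $\mathcal M'$ of $\mathcal T$, of any state dimension; it is also the maximum of $\delta_{\mathcal M'}$ over all these realizations. 3. There is $X>0$ with $W(X,\mathcal M_\Xi)\ge 0$. If $X=T^{\mathsf H}T$ with $T$ invertible and $W(X,\mathcal M_\Xi)\ge 0$, then $W(X,\mathcal M)>0$, and $\mathcal M_T$ is a port-Hamiltonian realization of $\mathcal T$ with $Q=I$ that attains both maxima: $\rho_{\mathcal M_T}(I)=\rho_{\mathcal M_T}=\delta_{\mathcal M_T}=\Xi/2$. 4. Conversely, if $X=T^{\mathsf H}T$ with $T$ invertible, $W(X,\mathcal M)>0$ and $\rho_{\mathcal M_T}(I)=\Xi/2$, then $W(X,\mathcal M_\Xi)\ge 0$. Moreover, a minimal realization $\mathcal M'$ of $\mathcal T$ has $\rho_{\mathcal M'}=\Xi/2$ if and only if there are an invertible $V$ and $X>0$ with $\mathcal M'=\{VAV^{-1},VB,CV^{-1},D\}$, $W(X,\mathcal M_\Xi)\ge 0$ and $\rho_{\mathcal M'}(V^{-\mathsf H}XV^{-1})=\Xi/2$. -/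

import Mathlib

open scoped Matrix ENNReal ComplexOrder

/-- A state-space model `{A, B, C, D}` with `n` states and `m` inputs and outputs:
`x' = A x + B u`, `y = C x + D u`. -/
@[ext]
structure StateSpace (n m : ℕ) where
  A : Matrix (Fin n) (Fin n) ℂ
  B : Matrix (Fin n) (Fin m) ℂ
  C : Matrix (Fin m) (Fin n) ℂ
  D : Matrix (Fin m) (Fin m) ℂ

/-- The two norms used to measure a perturbation of a model. -/
inductive NormKind where
  | spectral
  | frobenius

noncomputable section

namespace StateSpace

variable {n m k : ℕ}

/-- Entrywise sum; `M + Δ` is the model `M` perturbed by `Δ`. -/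
instance instAdd : Add (StateSpace n m) :=
  ⟨fun M N => ⟨M.A + N.A, M.B + N.B, M.C + N.C, M.D + N.D⟩⟩

/-- The transfer function `D + C (s I - A)⁻¹ B`; meaningful when `s` is not an eigenvalue of `A`. -/
def transfer (M : StateSpace n m) (s : ℂ) : Matrix (Fin m) (Fin m) ℂ :=
  M.D + M.C * (s • (1 : Matrix (Fin n) (Fin n) ℂ) - M.A)⁻¹ * M.B

/-- The two models realize the same rational transfer function: the values agree wherever
both are defined, that is, away from the finitely many eigenvalues of the two state matrices. -/
def SameTransfer (M : StateSpace n m) (M' : StateSpace k m) : Prop :=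
  ∀ s : ℂ, s ∉ spectrum ℂ M.A → s ∉ spectrum ℂ M'.A → M.transfer s = M'.transfer s

/-- Controllability of a pair: `rank [s I - A | B] = n` for all complex `s`. -/
def Controllable (A : Matrix (Fin n) (Fin n) ℂ) (B : Matrix (Fin n) (Fin m) ℂ) : Prop :=
  ∀ s : ℂ, (Matrix.fromCols (s • (1 : Matrix (Fin n) (Fin n) ℂ) - A) B).rank = n

/-- `(A, B)` is controllable and `(A, C)` is observable. -/
def Minimal (M : StateSpace n m) : Prop :=
  Controllable M.A M.B ∧ Controllable M.Aᴴ M.Cᴴ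

/-- Strict passivity: asymptotic stability (all eigenvalues of `A`, which are the poles of the
transfer function when the model is minimal, lie in the open left half plane), and positive
definiteness of `Φ(iω) = T(iω)ᴴ + T(iω)` for every real `ω` and for `ω = ∞`,
where `Φ(∞) = Dᴴ + D`. -/
def StrictlyPassive (M : StateSpace n m) : Prop :=
  (∀ z ∈ spectrum ℂ M.A, z.re < 0) ∧
  (∀ ω : ℝ, ((M.transfer (Complex.I * ω))ᴴ + M.transfer (Complex.I * ω)).PosDef) ∧
  (M.Dᴴ + M.D).PosDef

/-- The shifted model `{A + (ξ/2) I, B, C, D - (ξ/2) I}`, a realization of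
`T_ξ(s) = C ((s - ξ/2) I - A)⁻¹ B + D - (ξ/2) I`. -/
def shift (M : StateSpace n m) (ξ : ℝ) : StateSpace n m where
  A := M.A + ((ξ / 2 : ℝ) : ℂ) • (1 : Matrix (Fin n) (Fin n) ℂ)
  B := M.B
  C := M.C
  D := M.D - ((ξ / 2 : ℝ) : ℂ) • (1 : Matrix (Fin m) (Fin m) ℂ)

/-- `Ξ = sup {ξ | T_ξ is strictly passive}`. -/
def maxShift (M : StateSpace n m) : ℝ :=
  sSup {ξ : ℝ | (M.shift ξ).StrictlyPassive}

/-- The matrix `W(X, M)` of the passivity linear matrix inequality. -/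
def W (M : StateSpace n m) (X : Matrix (Fin n) (Fin n) ℂ) :
    Matrix (Fin n ⊕ Fin m) (Fin n ⊕ Fin m) ℂ :=
  Matrix.fromBlocks (-(M.Aᴴ * X) - X * M.A) (M.Cᴴ - X * M.B)
    (M.C - M.Bᴴ * X) (M.Dᴴ + M.D)

/-- The norm of the block matrix `[Δ_A Δ_B; Δ_C Δ_D]`: largest singular value (operator norm for
the Euclidean norms), or Frobenius norm. -/
def size (ν : NormKind) (Δ : StateSpace n m) : ℝ :=
  match ν with
  | .spectral =>
      ‖Matrix.toEuclideanCLM (𝕜 := ℂ) (Matrix.fromBlocks Δ.A Δ.B Δ.C Δ.D)‖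
  | .frobenius =>
      Real.sqrt (∑ i, ∑ j, ‖Matrix.fromBlocks Δ.A Δ.B Δ.C Δ.D i j‖ ^ 2)

/-- The `X`-passivity radius `inf {‖Δ‖ | det W(X, M + Δ) = 0}`, for `X > 0` with `W(X, M) > 0`. -/
def xPassivityRadius (ν : NormKind) (M : StateSpace n m) (X : Matrix (Fin n) (Fin n) ℂ) : ℝ≥0∞ :=
  ⨅ (Δ : StateSpace n m) (_ : ((M + Δ).W X).det = 0), ENNReal.ofReal (Δ.size ν)

/-- The passivity radius `ρ_M = sup_X inf {‖Δ‖ | det W(X, M + Δ) = 0}`, the supremum being over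
all `X > 0` with `W(X, M) > 0` (it is `0` when there is no such `X`). -/
def passivityRadius (ν : NormKind) (M : StateSpace n m) : ℝ≥0∞ :=
  ⨆ (X : Matrix (Fin n) (Fin n) ℂ) (_ : X.PosDef ∧ (M.W X).PosDef), xPassivityRadius ν M X

/-- The size of the smallest perturbation that destroys strict passivity of the model. -/
def passivityMargin (ν : NormKind) (M : StateSpace n m) : ℝ≥0∞ :=
  ⨅ (Δ : StateSpace n m) (_ : ¬ (M + Δ).StrictlyPassive), ENNReal.ofReal (Δ.size ν)

/-- The model in the new state `T x`, where `T'` is the inverse of `T`: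
`{T A T', T B, C T', D}`. -/
def transform (M : StateSpace n m) (T : Matrix (Fin k) (Fin n) ℂ)
    (T' : Matrix (Fin n) (Fin k) ℂ) : StateSpace k m :=
  ⟨T * M.A * T', T * M.B, M.C * T', M.D⟩

/-- The model is port-Hamiltonian with the given matrix `Q`:
`x' = (J - R) Q x + (G - K) u`, `y = (G + K)ᴴ Q x + (S + N) u` with `[J G; -Gᴴ N]`
skew-Hermitian, `[R K; Kᴴ S]` Hermitian positive semidefinite and `Q` Hermitian positive
definite. -/
def IsPortHamiltonian (M : StateSpace n m) (Q : Matrix (Fin n) (Fin n) ℂ) : Prop :=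
  Q.PosDef ∧
  ∃ (J R : Matrix (Fin n) (Fin n) ℂ) (G K : Matrix (Fin n) (Fin m) ℂ)
    (S N : Matrix (Fin m) (Fin m) ℂ),
    M.A = (J - R) * Q ∧ M.B = G - K ∧ M.C = (G + K)ᴴ * Q ∧ M.D = S + N ∧
    (Matrix.fromBlocks J G (-Gᴴ) N)ᴴ = -Matrix.fromBlocks J G (-Gᴴ) N ∧
    (Matrix.fromBlocks R K Kᴴ S).PosSemidef

end StateSpace

end

/-! The number `Ξ/2` is squeezed between two estimates. Write `E = diag(I, -I)`: the shift by `ξ`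
adds `(ξ/2)E` to the block matrix `[A B; C D]`.

Upper bound, for every realization. Strict passivity fails exactly when some nonzero vector `v` has
a forbidden image under the block matrix (`strictlyPassive_iff`). If the shifted model fails at `v`,
a rank one perturbation acting on `v` as `(ξ/2)E` does makes the unshifted model fail too. As `E` is
isometric, this costs at most `ξ/2`, in either norm. Poles of a minimal realization are eigenvalues
of every realization, so every `ξ > Ξ` is available; hence `δ ≤ Ξ/2`. Also `ρ ≤ δ`: `W > 0`
certifies strict passivity, so a perturbation that destroys the latter must have crossed `det W =
0`.

Lower bound. A radius at least `r > 0` at `X` means `2r ‖diag(-X, I)v‖ ‖v‖ ≤ vᴴ W(X) v` for all `v`,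
while `W(X, M_ξ) = W(X, M) - ξ diag(X, I)`. By Cauchy-Schwarz the radius condition with `r = ξ/2`
implies `W(X, M_ξ) ≥ 0`, and for `X = I` the two are equivalent. A solution `X = TᴴT` at `ξ = Ξ`
becomes `I` in the coordinates `Tx`, and there the chain `Ξ/2 ≤ ρ(I) ≤ ρ ≤ δ ≤ Ξ/2` closes.

Such an `X` comes from the strict Kalman-Yakubovich-Popov lemma for `ξ < Ξ`
(`StrictlyPassive.exists_W_posDef`, by separation) and compactness of the solution set of a minimal
model. The same compactness shows that a positive passivity radius is attained, which with the state
space isomorphism theorem gives the converse. -/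

open Matrix Filter Topology

/-! ### Quadratic forms of complex matrices and the positive definite cone. -/

namespace Matrix

variable {ι κ : Type*} [Fintype ι] [Fintype κ]

/-- The real part of the quadratic form of a complex matrix. -/
noncomputable def reQuad (H : Matrix ι ι ℂ) (v : ι → ℂ) : ℝ := (star v ⬝ᵥ H *ᵥ v).re

lemma reQuad_add (H K : Matrix ι ι ℂ) (v : ι → ℂ) :
    (H + K).reQuad v = H.reQuad v + K.reQuad v := by
  simp [reQuad, add_mulVec, dotProduct_add]

lemma reQuad_sub (H K : Matrix ι ι ℂ) (v : ι → ℂ) :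
    (H - K).reQuad v = H.reQuad v - K.reQuad v := by
  simp [reQuad, sub_mulVec, dotProduct_sub]

lemma reQuad_smul (t : ℝ) (H : Matrix ι ι ℂ) (v : ι → ℂ) :
    (t • H).reQuad v = t * H.reQuad v := by
  simp [reQuad, smul_mulVec, dotProduct_smul]

lemma reQuad_conjTranspose (H : Matrix ι ι ℂ) (v : ι → ℂ) : Hᴴ.reQuad v = H.reQuad v := by
  unfold reQuad
  have h : star v ⬝ᵥ Hᴴ *ᵥ v = star (star v ⬝ᵥ H *ᵥ v) := by
    rw [star_dotProduct, star_mulVec, ← dotProduct_mulVec, conjTranspose_conjTranspose]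
  rw [h]; simp

lemma reQuad_smul_vec (H : Matrix ι ι ℂ) (c : ℂ) (v : ι → ℂ) :
    H.reQuad (c • v) = ‖c‖ ^ 2 * H.reQuad v := by
  have : star (c • v) ⬝ᵥ H *ᵥ (c • v) = ((‖c‖ ^ 2 : ℝ) : ℂ) * (star v ⬝ᵥ H *ᵥ v) := by
    rw [mulVec_smul, star_smul, smul_dotProduct, dotProduct_smul, smul_smul, smul_eq_mul]
    congr 1
    rw [← Complex.normSq_eq_norm_sq, Complex.normSq_eq_conj_mul_self]; rfl
  rw [reQuad, this, Complex.re_ofReal_mul]; rfl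

lemma reQuad_mul_mul (H : Matrix ι ι ℂ) (T : Matrix ι κ ℂ) (v : κ → ℂ) :
    (Tᴴ * H * T).reQuad v = H.reQuad (T *ᵥ v) := by
  rw [reQuad, reQuad, star_mulVec, ← dotProduct_mulVec, mulVec_mulVec, mulVec_mulVec,
    Matrix.mul_assoc]

lemma star_dotProduct_self_eq (v : ι → ℂ) :
    star v ⬝ᵥ v = ((‖WithLp.toLp 2 v‖ ^ 2 : ℝ) : ℂ) := by
  rw [EuclideanSpace.norm_sq_eq]
  simp only [dotProduct, Pi.star_apply, Complex.ofReal_sum]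
  refine Finset.sum_congr rfl fun i _ => ?_
  rw [← Complex.normSq_eq_norm_sq, Complex.normSq_eq_conj_mul_self]; rfl

lemma reQuad_one [DecidableEq ι] (v : ι → ℂ) :
    (1 : Matrix ι ι ℂ).reQuad v = ‖WithLp.toLp 2 v‖ ^ 2 := by
  rw [reQuad, one_mulVec, star_dotProduct_self_eq, Complex.ofReal_re]

lemma norm_toLp_pos {v : ι → ℂ} (hv : v ≠ 0) : 0 < ‖WithLp.toLp 2 v‖ := by
  rw [norm_pos_iff]; simpa using hv

lemma norm_star_dotProduct_le (w v : ι → ℂ) :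
    ‖star w ⬝ᵥ v‖ ≤ ‖WithLp.toLp 2 w‖ * ‖WithLp.toLp 2 v‖ := by
  have := norm_inner_le_norm (𝕜 := ℂ) (WithLp.toLp 2 w) (WithLp.toLp 2 v)
  rwa [EuclideanSpace.inner_toLp_toLp, dotProduct_comm] at this

lemma IsHermitian.dotProduct_eq_reQuad {H : Matrix ι ι ℂ} (hH : H.IsHermitian) (v : ι → ℂ) :
    star v ⬝ᵥ H *ᵥ v = (H.reQuad v : ℂ) := by
  apply Complex.ext
  · simp [reQuad]
  · simpa using hH.im_star_dotProduct_mulVec_self v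

lemma IsHermitian.posDef_iff_reQuad {H : Matrix ι ι ℂ} (hH : H.IsHermitian) :
    H.PosDef ↔ ∀ v, v ≠ 0 → 0 < H.reQuad v := by
  rw [posDef_iff_dotProduct_mulVec]
  simp only [hH, true_and, hH.dotProduct_eq_reQuad, Complex.zero_lt_real, ne_eq]

lemma IsHermitian.posSemidef_iff_reQuad {H : Matrix ι ι ℂ} (hH : H.IsHermitian) :
    H.PosSemidef ↔ ∀ v, 0 ≤ H.reQuad v := by
  rw [posSemidef_iff_dotProduct_mulVec]
  simp only [hH, true_and, hH.dotProduct_eq_reQuad, Complex.zero_le_real]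

lemma PosDef.reQuad_pos {H : Matrix ι ι ℂ} (hH : H.PosDef) {v : ι → ℂ} (hv : v ≠ 0) :
    0 < H.reQuad v := hH.1.posDef_iff_reQuad.1 hH v hv

lemma PosSemidef.reQuad_nonneg {H : Matrix ι ι ℂ} (hH : H.PosSemidef) (v : ι → ℂ) :
    0 ≤ H.reQuad v := hH.1.posSemidef_iff_reQuad.1 hH v

lemma continuous_reQuad : Continuous fun p : Matrix ι ι ℂ × (ι → ℂ) => p.1.reQuad p.2 := by
  unfold reQuad
  fun_prop

lemma PosSemidef.mulVec_eq_zero {H : Matrix ι ι ℂ} (hH : H.PosSemidef) {v : ι → ℂ}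
    (hv : H.reQuad v = 0) : H *ᵥ v = 0 := by
  classical
  rw [← hH.dotProduct_mulVec_zero_iff, hH.1.dotProduct_eq_reQuad, hv, Complex.ofReal_zero]

lemma PosSemidef.posDef_of_det_ne_zero [DecidableEq ι] {H : Matrix ι ι ℂ} (hH : H.PosSemidef)
    (hd : H.det ≠ 0) : H.PosDef := by
  rw [hH.1.posDef_iff_reQuad]
  intro v hv
  refine lt_of_le_of_ne (hH.reQuad_nonneg v) fun h => hv ?_
  exact Matrix.eq_zero_of_mulVec_eq_zero hd (hH.mulVec_eq_zero h.symm)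

/-- By homogeneity only the unit sphere matters, and it is compact. Symmetry is not imposed: the
positive definite cone is open only among Hermitian matrices, whereas this set is open among all
matrices, as the separation theorem requires. -/
lemma isOpen_setOf_reQuad_pos : IsOpen {H : Matrix ι ι ℂ | ∀ v, v ≠ 0 → 0 < H.reQuad v} := by
  rw [isOpen_iff_mem_nhds]
  intro H hH
  have key : ∀ᶠ K in nhds H, ∀ v ∈ Metric.sphere (0 : ι → ℂ) 1, 0 < K.reQuad v := by
    refine (isCompact_sphere (0 : ι → ℂ) 1).eventually_forall_of_forall_eventually fun v hv => ?_
    have hv0 : v ≠ 0 := by rintro rfl; simp at hv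
    exact continuous_reQuad.continuousAt.eventually_const_lt (hH v hv0)
  filter_upwards [key] with K hK v hv
  have h1 := hK (((‖v‖⁻¹ : ℝ) : ℂ) • v) (by simp [norm_smul, hv])
  rw [reQuad_smul_vec] at h1
  exact pos_of_mul_pos_right h1 (by positivity)

lemma isClosed_setOf_posSemidef : IsClosed {H : Matrix ι ι ℂ | H.PosSemidef} := by
  have : {H : Matrix ι ι ℂ | H.PosSemidef} = {H | Hᴴ = H} ∩ ⋂ v, {H | 0 ≤ H.reQuad v} := by
    ext H
    simp only [Set.mem_ofPred_eq, Set.mem_inter_iff, Set.mem_iInter]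
    exact ⟨fun h => ⟨h.1, h.reQuad_nonneg⟩,
      fun h => (IsHermitian.posSemidef_iff_reQuad (H := H) h.1).2 h.2⟩
  rw [this]
  refine (isClosed_eq (by fun_prop) continuous_id).inter (isClosed_iInter fun v => ?_)
  exact isClosed_le continuous_const (continuous_reQuad.comp (by fun_prop : Continuous fun H => (H, v)))

/-- A segment of Hermitian matrices that leaves the positive definite cone meets the singular
matrices. -/
lemma PosDef.exists_det_eq_zero [DecidableEq ι] {H K : Matrix ι ι ℂ} (hH : H.PosDef)
    (hK : K.IsHermitian) (hn : ¬ (H + K).PosDef) :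
    ∃ t ∈ Set.Icc (0 : ℝ) 1, (H + t • K).det = 0 := by
  by_contra! hc
  have hherm : ∀ t : ℝ, (H + t • K).IsHermitian := fun t => by
    rw [IsHermitian, conjTranspose_add, conjTranspose_smul, hH.1, hK]; simp
  have hcont : Continuous fun t : ℝ => H + t • K := by fun_prop
  have hU := isOpen_setOf_reQuad_pos.preimage hcont
  have hV : IsOpen {t : ℝ | ∃ v, (H + t • K).reQuad v < 0} := by
    simp only [Set.ofPred_exists]
    refine isOpen_iUnion fun v => isOpen_lt ?_ continuous_const
    exact continuous_reQuad.comp (hcont.prodMk continuous_const)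
  have hd : ∀ t ∈ Set.Icc (0 : ℝ) 1, ¬ (H + t • K).PosDef → ∃ v, (H + t • K).reQuad v < 0 := by
    intro t ht hnp
    by_contra! hge
    exact hnp (((hherm t).posSemidef_iff_reQuad.2 hge).posDef_of_det_ne_zero (hc t ht))
  -- Without a singular matrix on the segment, "positive definite" and "negative somewhere" would be
  -- two open sets covering `[0, 1]`, each met at an endpoint; connectedness gives a common point.
  obtain ⟨t, -, ht1, v, ht2⟩ := isPreconnected_Icc (a := (0 : ℝ)) (b := 1) _ _ hU hV
    (fun t ht => by
      by_cases h : (H + t • K).PosDef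
      · exact Or.inl fun v hv => h.reQuad_pos hv
      · exact Or.inr (hd t ht h))
    ⟨0, by simp, fun v hv => by simpa using hH.reQuad_pos hv⟩
    ⟨1, by simp, hd 1 (by simp) (by simpa using hn)⟩
  by_cases hv : v = 0
  · simp [hv, reQuad] at ht2
  · exact absurd (ht1 v hv) (not_lt.2 ht2.le)

end Matrix

/-! ### Perturbation norms, and the `X`-passivity radius as a quadratic inequality. -/

namespace StateSpace

variable {n m k : ℕ}

/-- The block matrix `[A B; C D]` of a model. -/
def mat (M : StateSpace n m) : Matrix (Fin n ⊕ Fin m) (Fin n ⊕ Fin m) ℂ :=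
  fromBlocks M.A M.B M.C M.D

/-- The model with a given block matrix. -/
def ofMat (N : Matrix (Fin n ⊕ Fin m) (Fin n ⊕ Fin m) ℂ) : StateSpace n m :=
  ⟨N.toBlocks₁₁, N.toBlocks₁₂, N.toBlocks₂₁, N.toBlocks₂₂⟩

@[simp] lemma mat_ofMat (N : Matrix (Fin n ⊕ Fin m) (Fin n ⊕ Fin m) ℂ) : (ofMat N).mat = N :=
  fromBlocks_toBlocks N

lemma mat_add (M N : StateSpace n m) : (M + N).mat = M.mat + N.mat :=
  (fromBlocks_add ..).symm

lemma spectral_le_frobenius {ι : Type*} [Fintype ι] [DecidableEq ι] (N : Matrix ι ι ℂ) :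
    ‖toEuclideanCLM (𝕜 := ℂ) N‖ ≤ Real.sqrt (∑ i, ∑ j, ‖N i j‖ ^ 2) := by
  refine ContinuousLinearMap.opNorm_le_bound _ (Real.sqrt_nonneg _) fun v => ?_
  rw [← Real.sqrt_sq (norm_nonneg v), ← Real.sqrt_mul (by positivity),
    ← Real.sqrt_sq (norm_nonneg (toEuclideanCLM (𝕜 := ℂ) N v))]
  refine Real.sqrt_le_sqrt ?_
  rw [EuclideanSpace.norm_sq_eq, EuclideanSpace.norm_sq_eq, Finset.sum_mul]
  refine Finset.sum_le_sum fun i _ => ?_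
  have h1 : ‖(toEuclideanCLM (𝕜 := ℂ) N v) i‖ ≤ ∑ j, ‖N i j‖ * ‖v j‖ := by
    have : (toEuclideanCLM (𝕜 := ℂ) N v) i = ∑ j, N i j * v j := by
      rw [ofLp_toEuclideanCLM]; rfl
    rw [this]
    exact (norm_sum_le _ _).trans (by simp)
  calc _ ≤ (∑ j, ‖N i j‖ * ‖v j‖) ^ 2 := by gcongr
    _ ≤ _ := Finset.sum_mul_sq_le_sq_mul_sq ..

lemma spectral_le_size (ν : NormKind) (Δ : StateSpace n m) :
    ‖toEuclideanCLM (𝕜 := ℂ) Δ.mat‖ ≤ Δ.size ν := by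
  cases ν
  · exact le_rfl
  · exact spectral_le_frobenius _

lemma size_le_frobenius (ν : NormKind) (Δ : StateSpace n m) :
    Δ.size ν ≤ Real.sqrt (∑ i, ∑ j, ‖Δ.mat i j‖ ^ 2) := by
  cases ν
  · exact spectral_le_frobenius _
  · exact le_rfl

lemma size_nonneg (ν : NormKind) (Δ : StateSpace n m) : 0 ≤ Δ.size ν :=
  (norm_nonneg _).trans (spectral_le_size ν Δ)

lemma norm_dotProduct_mulVec_le_size (ν : NormKind) (Δ : StateSpace n m)
    (w v : Fin n ⊕ Fin m → ℂ) :
    ‖star w ⬝ᵥ Δ.mat *ᵥ v‖ ≤ Δ.size ν * (‖WithLp.toLp 2 w‖ * ‖WithLp.toLp 2 v‖) := by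
  refine (norm_star_dotProduct_le _ _).trans ?_
  have h := (toEuclideanCLM (𝕜 := ℂ) Δ.mat).le_opNorm (WithLp.toLp 2 v)
  rw [toEuclideanCLM_toLp] at h
  have h2 := h.trans (mul_le_mul_of_nonneg_right (spectral_le_size ν Δ) (norm_nonneg _))
  calc _ ≤ ‖WithLp.toLp 2 w‖ * (Δ.size ν * ‖WithLp.toLp 2 v‖) := by gcongr
    _ = _ := by ring

/-- On rank one matrices the two norms agree. All extremal perturbations below are of rank one, and
this is why the theorem reads the same for both norms. -/
lemma size_ofMat_vecMulVec_le (ν : NormKind) (w v : Fin n ⊕ Fin m → ℂ) :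
    (ofMat (vecMulVec w (star v)) : StateSpace n m).size ν ≤
      ‖WithLp.toLp 2 w‖ * ‖WithLp.toLp 2 v‖ := by
  refine (size_le_frobenius ν _).trans (le_of_eq ?_)
  rw [← Real.sqrt_sq (by positivity : 0 ≤ ‖WithLp.toLp 2 w‖ * ‖WithLp.toLp 2 v‖), mul_pow,
    EuclideanSpace.norm_sq_eq, EuclideanSpace.norm_sq_eq, Finset.sum_mul_sum]
  simp [vecMulVec_apply, mul_pow]

lemma size_ofMat_smul (ν : NormKind) (t : ℝ) (Δ : StateSpace n m) :
    (ofMat (t • Δ.mat)).size ν = |t| * Δ.size ν := by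
  cases ν
  · have : ∀ Γ : StateSpace n m, Γ.size .spectral = ‖toEuclideanCLM (𝕜 := ℂ) Γ.mat‖ := fun _ => rfl
    rw [this, this, mat_ofMat]
    have h : (t • Δ.mat) = (t : ℂ) • Δ.mat := by ext; simp
    rw [h, map_smul, norm_smul, Complex.norm_real, Real.norm_eq_abs]
  · have : ∀ Γ : StateSpace n m,
      Γ.size .frobenius = Real.sqrt (∑ i, ∑ j, ‖Γ.mat i j‖ ^ 2) := fun _ => rfl
    rw [this, this, mat_ofMat, ← Real.sqrt_sq_eq_abs, ← Real.sqrt_mul (sq_nonneg t),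
      Finset.mul_sum]
    simp only [Finset.mul_sum, Matrix.smul_apply, norm_smul, Real.norm_eq_abs, mul_pow, sq_abs]

/-- The weight `diag (-X, I)`. -/
def weight (X : Matrix (Fin n) (Fin n) ℂ) : Matrix (Fin n ⊕ Fin m) (Fin n ⊕ Fin m) ℂ :=
  fromBlocks (-X) 0 0 1

/-- Exhibits `W` as linear in the model, so that a perturbation changes it by twice the Hermitian
part of `weight X * Δ.mat`. -/
lemma W_eq (M : StateSpace n m) {X : Matrix (Fin n) (Fin n) ℂ} (hX : X.IsHermitian) :
    M.W X = weight X * M.mat + (weight X * M.mat)ᴴ := by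
  have hX' : Xᴴ = X := hX
  simp only [W, weight, mat, fromBlocks_multiply, fromBlocks_conjTranspose, fromBlocks_add,
    conjTranspose_mul, conjTranspose_neg, hX', Matrix.zero_mul, Matrix.one_mul, zero_add,
    add_zero, neg_mul]
  congr 1 <;> (try simp) <;> abel

lemma W_isHermitian (M : StateSpace n m) {X : Matrix (Fin n) (Fin n) ℂ} (hX : X.IsHermitian) :
    (M.W X).IsHermitian := by
  rw [M.W_eq hX, IsHermitian, conjTranspose_add, conjTranspose_conjTranspose, add_comm]

lemma W_add (M Δ : StateSpace n m) {X : Matrix (Fin n) (Fin n) ℂ} (hX : X.IsHermitian) :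
    (M + Δ).W X = M.W X + (weight X * Δ.mat + (weight X * Δ.mat)ᴴ) := by
  rw [W_eq _ hX, W_eq _ hX, mat_add, mul_add, conjTranspose_add]
  abel

lemma reQuad_weight_mul (X : Matrix (Fin n) (Fin n) ℂ) (hX : X.IsHermitian)
    (N : Matrix (Fin n ⊕ Fin m) (Fin n ⊕ Fin m) ℂ) (v : Fin n ⊕ Fin m → ℂ) :
    (weight X * N + (weight X * N)ᴴ).reQuad v =
      2 * (star ((weight X : Matrix (Fin n ⊕ Fin m) (Fin n ⊕ Fin m) ℂ) *ᵥ v) ⬝ᵥ N *ᵥ v).re := by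
  have hw : (weight X : Matrix (Fin n ⊕ Fin m) (Fin n ⊕ Fin m) ℂ)ᴴ = weight X := by
    have hX' : Xᴴ = X := hX
    simp [weight, fromBlocks_conjTranspose, hX']
  rw [reQuad_add, reQuad_conjTranspose, reQuad, star_mulVec, hw, ← dotProduct_mulVec,
    mulVec_mulVec]
  ring

lemma reQuad_W_add (M Δ : StateSpace n m) {X : Matrix (Fin n) (Fin n) ℂ} (hX : X.IsHermitian)
    (v : Fin n ⊕ Fin m → ℂ) :
    ((M + Δ).W X).reQuad v = (M.W X).reQuad v +
      2 * (star ((weight X : Matrix (Fin n ⊕ Fin m) (Fin n ⊕ Fin m) ℂ) *ᵥ v) ⬝ᵥ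
        Δ.mat *ᵥ v).re := by
  rw [W_add _ _ hX, reQuad_add, reQuad_weight_mul _ hX]

lemma weight_mulVec_ne_zero {X : Matrix (Fin n) (Fin n) ℂ} (hX : X.PosDef)
    {v : Fin n ⊕ Fin m → ℂ} (hv : v ≠ 0) :
    (weight X : Matrix (Fin n ⊕ Fin m) (Fin n ⊕ Fin m) ℂ) *ᵥ v ≠ 0 := by
  intro h
  refine hv (eq_zero_of_mulVec_eq_zero ?_ h)
  rw [weight, det_fromBlocks_zero₂₁, det_neg, det_one, mul_one]
  exact mul_ne_zero (by simp) hX.det_pos.ne'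

/-- Along the segment from a model with `W > 0` to one without, some `W` is singular. -/
lemma xPassivityRadius_le_size (ν : NormKind) {M Δ : StateSpace n m}
    {X : Matrix (Fin n) (Fin n) ℂ} (hX : X.PosDef) (hW : (M.W X).PosDef)
    (h : ¬ ((M + Δ).W X).PosDef) : M.xPassivityRadius ν X ≤ ENNReal.ofReal (Δ.size ν) := by
  rw [W_add _ _ hX.1] at h
  obtain ⟨t, ht, hdet⟩ := hW.exists_det_eq_zero (by
    rw [IsHermitian, conjTranspose_add, conjTranspose_conjTranspose, add_comm]) h
  refine (iInf₂_le (ofMat (t • Δ.mat)) ?_).trans (ENNReal.ofReal_le_ofReal ?_)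
  · rw [W_add _ _ hX.1, mat_ofMat]
    convert hdet using 3
    rw [Matrix.mul_smul, conjTranspose_smul, smul_add]
    simp
  · rw [size_ofMat_smul, abs_of_nonneg ht.1]
    exact mul_le_of_le_one_left (size_nonneg ν Δ) ht.2

/-- At a kernel vector `v` of the perturbed `W`, the form of `W` equals `-2 Re ⟨diag(-X, I)v, Δv⟩`,
which is at most `2‖Δ‖ ‖diag(-X, I)v‖ ‖v‖`. -/
lemma ofReal_le_xPassivityRadius (ν : NormKind) {M : StateSpace n m}
    {X : Matrix (Fin n) (Fin n) ℂ} (hX : X.PosDef) {r : ℝ}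
    (h : ∀ v, 2 * r * (‖WithLp.toLp 2 ((weight X : Matrix (Fin n ⊕ Fin m) _ ℂ) *ᵥ v)‖ *
      ‖WithLp.toLp 2 v‖) ≤ (M.W X).reQuad v) :
    ENNReal.ofReal r ≤ M.xPassivityRadius ν X := by
  refine le_iInf₂ fun Δ hΔ => ENNReal.ofReal_le_ofReal ?_
  obtain ⟨v, hv, hv0⟩ := exists_mulVec_eq_zero_iff.2 hΔ
  have h1 := reQuad_W_add M Δ hX.1 v
  rw [reQuad, hv0, dotProduct_zero, Complex.zero_re] at h1
  have h2 := norm_dotProduct_mulVec_le_size ν Δ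
    ((weight X : Matrix (Fin n ⊕ Fin m) (Fin n ⊕ Fin m) ℂ) *ᵥ v) v
  have h3 := (Complex.abs_re_le_norm _).trans h2
  have h4 := neg_le_of_abs_le h3
  have hpos := mul_pos (norm_toLp_pos (weight_mulVec_ne_zero hX hv)) (norm_toLp_pos hv)
  have h5 := h v
  exact le_of_mul_le_mul_right (by linarith) hpos

/-- The bound of `ofReal_le_xPassivityRadius` is sharp: for each `v` a rank one perturbation in the
direction of `diag(-X, I)v` attains it. -/
lemma le_reQuad_of_ofReal_le_xPassivityRadius (ν : NormKind) {M : StateSpace n m}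
    {X : Matrix (Fin n) (Fin n) ℂ} (hX : X.PosDef) (hW : (M.W X).PosDef) {r : ℝ}
    (h : ENNReal.ofReal r ≤ M.xPassivityRadius ν X) (v : Fin n ⊕ Fin m → ℂ) :
    2 * r * (‖WithLp.toLp 2 ((weight X : Matrix (Fin n ⊕ Fin m) (Fin n ⊕ Fin m) ℂ) *ᵥ v)‖ *
      ‖WithLp.toLp 2 v‖) ≤ (M.W X).reQuad v := by
  by_cases hv : v = 0
  · simp [hv, reQuad]
  set y := (weight X : Matrix (Fin n ⊕ Fin m) (Fin n ⊕ Fin m) ℂ) *ᵥ v with hy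
  have hyp : 0 < ‖WithLp.toLp 2 y‖ := norm_toLp_pos (weight_mulVec_ne_zero hX hv)
  have hvp := norm_toLp_pos hv
  have hq := hW.reQuad_pos hv
  set a := ‖WithLp.toLp 2 y‖
  set b := ‖WithLp.toLp 2 v‖
  set s := (M.W X).reQuad v
  -- Chosen so that `2c a² b² = s`: the perturbation brings the form at `v` from `s` down to exactly
  -- `0`, at cost at most `s / (2ab)`.
  set c : ℝ := s / (2 * a ^ 2 * b ^ 2) with hc
  let Δ : StateSpace n m := ofMat (vecMulVec ((-c : ℂ) • y) (star v))
  have hsize : Δ.size ν ≤ c * (a * b) := by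
    refine (size_ofMat_vecMulVec_le ν _ _).trans (le_of_eq ?_)
    rw [WithLp.toLp_smul, norm_smul, norm_neg, Complex.norm_real, Real.norm_eq_abs,
      abs_of_pos (by positivity)]
    ring
  have hnot : ¬ ((M + Δ).W X).PosDef := by
    intro hpd
    have h1 := hpd.reQuad_pos hv
    rw [reQuad_W_add _ _ hX.1, ← hy, mat_ofMat, vecMulVec_mulVec, star_dotProduct_self_eq] at h1
    simp only [op_smul_eq_smul, dotProduct_smul, star_dotProduct_self_eq,
      smul_eq_mul] at h1
    rw [show (((b ^ 2 : ℝ) : ℂ) * (-(c : ℂ) * ((a ^ 2 : ℝ) : ℂ))) =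
      ((-(c * a ^ 2 * b ^ 2) : ℝ) : ℂ) by push_cast; ring, Complex.ofReal_re] at h1
    have : c * a ^ 2 * b ^ 2 = s / 2 := by rw [hc]; field_simp
    rw [this] at h1
    change 0 < s + _ at h1
    linarith
  have h2 := (ENNReal.ofReal_le_ofReal_iff (by positivity)).1
    ((h.trans (xPassivityRadius_le_size ν hX hW hnot)).trans (ENNReal.ofReal_le_ofReal hsize))
  calc 2 * r * (a * b) ≤ 2 * (c * (a * b)) * (a * b) := by gcongr
    _ = s := by rw [hc]; field_simp

end StateSpace

/-! ### Strict passivity through forbidden vectors, and the upper bound on the margin. -/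

lemma Matrix.mem_spectrum_iff_exists_mulVec {ι : Type*} [Fintype ι] [DecidableEq ι]
    (A : Matrix ι ι ℂ) (z : ℂ) : z ∈ spectrum ℂ A ↔ ∃ q, q ≠ 0 ∧ A *ᵥ q = z • q := by
  rw [spectrum.mem_iff, isUnit_iff_isUnit_det, isUnit_iff_ne_zero, not_not,
    ← exists_mulVec_eq_zero_iff]
  refine exists_congr fun q => and_congr_right fun _ => ?_
  rw [sub_mulVec, Algebra.algebraMap_eq_smul_one, smul_mulVec, one_mulVec, sub_eq_zero, eq_comm]

lemma Matrix.isUnit_det_smul_one_sub {ι : Type*} [Fintype ι] [DecidableEq ι]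
    {A : Matrix ι ι ℂ} {z : ℂ} (hz : z ∉ spectrum ℂ A) : IsUnit (z • (1 : Matrix ι ι ℂ) - A).det := by
  rw [← isUnit_iff_isUnit_det, ← Algebra.algebraMap_eq_smul_one]
  exact not_not.1 hz

namespace StateSpace

variable {n m k : ℕ}

/-- A pair `v = (q, u)`, `y = (a, b)` that shows that a model with `mat v = y` is not strictly
passive: an unstable eigenvector, or a failure of positivity at a finite or infinite frequency. -/
def Obstruction (v y : Fin n ⊕ Fin m → ℂ) : Prop :=
  (∃ s : ℂ, 0 ≤ s.re ∧ y ∘ Sum.inl = s • (v ∘ Sum.inl) ∧ v ∘ Sum.inr = 0) ∨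
  (∃ ω : ℝ, y ∘ Sum.inl = (Complex.I * ω) • (v ∘ Sum.inl) ∧
    (star (v ∘ Sum.inr) ⬝ᵥ (y ∘ Sum.inr)).re ≤ 0) ∨
  (v ∘ Sum.inl = 0 ∧ (star (v ∘ Sum.inr) ⬝ᵥ (y ∘ Sum.inr)).re ≤ 0)

lemma mat_mulVec_inl (M : StateSpace n m) (v : Fin n ⊕ Fin m → ℂ) :
    (M.mat *ᵥ v) ∘ Sum.inl = M.A *ᵥ (v ∘ Sum.inl) + M.B *ᵥ (v ∘ Sum.inr) := by
  rw [mat, fromBlocks_mulVec]; rfl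

lemma mat_mulVec_inr (M : StateSpace n m) (v : Fin n ⊕ Fin m → ℂ) :
    (M.mat *ᵥ v) ∘ Sum.inr = M.C *ᵥ (v ∘ Sum.inl) + M.D *ᵥ (v ∘ Sum.inr) := by
  rw [mat, fromBlocks_mulVec]; rfl

lemma eq_zero_of_comp {v : Fin n ⊕ Fin m → ℂ} (h1 : v ∘ Sum.inl = 0) (h2 : v ∘ Sum.inr = 0) :
    v = 0 := by
  ext (i | i)
  exacts [congrFun h1 i, congrFun h2 i]

lemma reQuad_conjTranspose_add_self (T : Matrix (Fin m) (Fin m) ℂ) (u : Fin m → ℂ) :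
    (Tᴴ + T).reQuad u = 2 * (star u ⬝ᵥ T *ᵥ u).re := by
  rw [reQuad_add, reQuad_conjTranspose, reQuad]; ring

lemma isHermitian_conjTranspose_add_self (T : Matrix (Fin m) (Fin m) ℂ) :
    (Tᴴ + T).IsHermitian := by
  rw [IsHermitian, conjTranspose_add, conjTranspose_conjTranspose, add_comm]

/-- The equation `(iω) q = A q + B u` says `q = (iω - A)⁻¹ B u`, and then `C q + D u = T(iω) u`. The
criterion involves the model only through its action on one vector, which makes rank one
perturbations sufficient. -/
theorem strictlyPassive_iff (M : StateSpace n m) :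
    M.StrictlyPassive ↔ ∀ v, v ≠ 0 → ¬ Obstruction v (M.mat *ᵥ v) := by
  constructor
  · rintro ⟨hA, hΦ, hD⟩ v hv h
    have hre : ∀ s : ℂ, 0 ≤ s.re → M.A *ᵥ (v ∘ Sum.inl) = s • (v ∘ Sum.inl) →
        v ∘ Sum.inl = 0 := by
      intro s hs hq
      by_contra hq0
      exact absurd (hA s ((mem_spectrum_iff_exists_mulVec _ _).2 ⟨_, hq0, hq⟩)) (not_lt.2 hs)
    rw [Obstruction, mat_mulVec_inl, mat_mulVec_inr] at h
    rcases h with ⟨s, hs, hq, hu⟩ | ⟨ω, hq, hu⟩ | ⟨hq, hu⟩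
    · rw [hu, mulVec_zero, add_zero] at hq
      exact hv (eq_zero_of_comp (hre s hs hq) hu)
    · have hs : 0 ≤ (Complex.I * ω).re := by simp
      by_cases hu0 : v ∘ Sum.inr = 0
      · rw [hu0, mulVec_zero, add_zero] at hq
        exact hv (eq_zero_of_comp (hre _ hs hq) hu0)
      · have hdet := isUnit_det_smul_one_sub
          (fun h => absurd (hA _ h) (not_lt.2 hs) : Complex.I * ω ∉ spectrum ℂ M.A)
        have hq' : v ∘ Sum.inl = ((Complex.I * ω) • (1 : Matrix (Fin n) (Fin n) ℂ) - M.A)⁻¹ *ᵥ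
            (M.B *ᵥ (v ∘ Sum.inr)) := by
          have : M.B *ᵥ (v ∘ Sum.inr) =
              ((Complex.I * ω) • (1 : Matrix (Fin n) (Fin n) ℂ) - M.A) *ᵥ (v ∘ Sum.inl) := by
            rw [sub_mulVec, smul_mulVec, one_mulVec, ← hq]; abel
          rw [this, mulVec_mulVec, nonsing_inv_mul _ hdet, one_mulVec]
        have := (hΦ ω).reQuad_pos hu0
        rw [reQuad_conjTranspose_add_self, transfer, add_mulVec, ← mulVec_mulVec,
          ← mulVec_mulVec, ← hq', add_comm (M.D *ᵥ _)] at this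
        linarith
    · have hu0 : v ∘ Sum.inr ≠ 0 := fun h => hv (eq_zero_of_comp hq h)
      have := hD.reQuad_pos hu0
      rw [hq, mulVec_zero, zero_add] at hu
      rw [reQuad_conjTranspose_add_self] at this
      linarith
  · intro h
    have hA : ∀ z ∈ spectrum ℂ M.A, z.re < 0 := by
      intro z hz
      by_contra hre
      obtain ⟨q, hq0, hq⟩ := (mem_spectrum_iff_exists_mulVec _ _).1 hz
      refine h (Sum.elim q 0) (fun h0 => hq0 ?_) (Or.inl ⟨z, not_lt.1 hre, ?_, ?_⟩)
      · simpa using congrArg (· ∘ Sum.inl) h0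
      · simp [mat_mulVec_inl, hq]
      · simp
    refine ⟨hA, fun ω => ?_, ?_⟩
    · rw [(isHermitian_conjTranspose_add_self _).posDef_iff_reQuad]
      intro u hu
      by_contra hle
      have hdet := isUnit_det_smul_one_sub
          (fun h => absurd (hA _ h) (by simp) : Complex.I * ω ∉ spectrum ℂ M.A)
      set q := ((Complex.I * ω) • (1 : Matrix (Fin n) (Fin n) ℂ) - M.A)⁻¹ *ᵥ (M.B *ᵥ u) with hq
      have hBu : M.B *ᵥ u = (Complex.I * ω) • q - M.A *ᵥ q := by
        have : ((Complex.I * ω) • (1 : Matrix (Fin n) (Fin n) ℂ) - M.A) *ᵥ q = M.B *ᵥ u := by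
          rw [hq, mulVec_mulVec, mul_nonsing_inv _ hdet, one_mulVec]
        rw [← this, sub_mulVec, smul_mulVec, one_mulVec]
      rw [reQuad_conjTranspose_add_self, transfer, add_mulVec, ← mulVec_mulVec,
          ← mulVec_mulVec, ← hq, add_comm (M.D *ᵥ _)] at hle
      refine h (Sum.elim q u) (fun h0 => hu ?_) (Or.inr (Or.inl ⟨ω, ?_, ?_⟩))
      · simpa using congrArg (· ∘ Sum.inr) h0
      · rw [mat_mulVec_inl]
        simp [hBu]
      · rw [mat_mulVec_inr]
        simp only [Sum.elim_comp_inr, Sum.elim_comp_inl]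
        linarith
    · rw [(isHermitian_conjTranspose_add_self _).posDef_iff_reQuad]
      intro u hu
      by_contra hle
      rw [reQuad_conjTranspose_add_self] at hle
      refine h (Sum.elim 0 u) (fun h0 => hu ?_) (Or.inr (Or.inr ⟨by simp, ?_⟩))
      · simpa using congrArg (· ∘ Sum.inr) h0
      · rw [mat_mulVec_inr]
        simp only [Sum.elim_comp_inr, Sum.elim_comp_inl, mulVec_zero, zero_add]
        linarith

lemma weight_mulVec (X : Matrix (Fin n) (Fin n) ℂ) (v : Fin n ⊕ Fin m → ℂ) :
    (weight X : Matrix (Fin n ⊕ Fin m) (Fin n ⊕ Fin m) ℂ) *ᵥ v =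
      Sum.elim (-(X *ᵥ (v ∘ Sum.inl))) (v ∘ Sum.inr) := by
  rw [weight, fromBlocks_mulVec]
  simp [neg_mulVec]

/-- The dissipation balance: supplied power minus growth of the stored energy `qᴴ X q`. -/
lemma reQuad_W (M : StateSpace n m) {X : Matrix (Fin n) (Fin n) ℂ} (hX : X.IsHermitian)
    (v : Fin n ⊕ Fin m → ℂ) :
    (M.W X).reQuad v = 2 * ((star (v ∘ Sum.inr) ⬝ᵥ ((M.mat *ᵥ v) ∘ Sum.inr)).re -
      (star (v ∘ Sum.inl) ⬝ᵥ X *ᵥ ((M.mat *ᵥ v) ∘ Sum.inl)).re) := by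
  have h1 : star (v ∘ Sum.inl) ⬝ᵥ X *ᵥ ((M.mat *ᵥ v) ∘ Sum.inl) =
      star (X *ᵥ (v ∘ Sum.inl)) ⬝ᵥ ((M.mat *ᵥ v) ∘ Sum.inl) := by
    rw [star_mulVec, ← dotProduct_mulVec, hX]
  rw [h1, W_eq _ hX, reQuad_weight_mul _ hX, weight_mulVec]
  simp only [dotProduct, Fintype.sum_sum_type, Pi.star_apply, Sum.elim_inl, Sum.elim_inr,
    Function.comp_apply, Pi.neg_apply, star_neg, neg_mul, Finset.sum_neg_distrib, Complex.add_re,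
    Complex.neg_re]
  ring

/-- At each of the three kinds of obstruction the stored energy does not decrease and no power is
supplied, so the form of `W` is at most `0`. -/
theorem strictlyPassive_of_W_posDef {M : StateSpace n m} {X : Matrix (Fin n) (Fin n) ℂ}
    (hX : X.PosDef) (hW : (M.W X).PosDef) : M.StrictlyPassive := by
  rw [strictlyPassive_iff]
  intro v hv h
  have hpos := hW.reQuad_pos hv
  rw [M.reQuad_W hX.1] at hpos
  have hq : ∀ s : ℂ, (star (v ∘ Sum.inl) ⬝ᵥ X *ᵥ (s • (v ∘ Sum.inl))).re =
      s.re * X.reQuad (v ∘ Sum.inl) := by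
    intro s
    rw [mulVec_smul, dotProduct_smul, hX.1.dotProduct_eq_reQuad, smul_eq_mul, Complex.re_mul_ofReal]
  have hXq := hX.posSemidef.reQuad_nonneg (v ∘ Sum.inl)
  rcases h with ⟨s, hs, h1, h2⟩ | ⟨ω, h1, h2⟩ | ⟨h1, h2⟩
  · rw [h1, hq, h2] at hpos
    simp only [star_zero, zero_dotProduct, Complex.zero_re, zero_sub] at hpos
    nlinarith [mul_nonneg hs hXq]
  · rw [h1, hq] at hpos
    simp only [Complex.re_mul_ofReal, Complex.I_re, zero_mul, sub_zero] at hpos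
    linarith
  · rw [h1] at hpos
    simp only [star_zero, zero_dotProduct, Complex.zero_re, sub_zero] at hpos
    linarith

theorem passivityRadius_le_passivityMargin (ν : NormKind) (M : StateSpace n m) :
    M.passivityRadius ν ≤ M.passivityMargin ν :=
  iSup₂_le fun _ hX => le_iInf₂ fun _ hΔ =>
    xPassivityRadius_le_size ν hX.1 hX.2 fun h => hΔ (strictlyPassive_of_W_posDef hX.1 h)

lemma mat_shift_mulVec (M : StateSpace n m) (ξ : ℝ) (v : Fin n ⊕ Fin m → ℂ) :
    (M.shift ξ).mat *ᵥ v = M.mat *ᵥ v +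
      ((ξ / 2 : ℝ) : ℂ) • Sum.elim (v ∘ Sum.inl) (-(v ∘ Sum.inr)) := by
  rw [mat, mat, fromBlocks_mulVec, fromBlocks_mulVec]
  ext (i | i)
  · simp [shift, add_mulVec, smul_mulVec]; ring
  · simp [shift, sub_mulVec, smul_mulVec]; ring

/-- A shift that destroys strict passivity yields a rank one perturbation that does the same. -/
theorem passivityMargin_le_of_not_strictlyPassive_shift (ν : NormKind) (M : StateSpace n m) {ξ : ℝ}
    (hξ : 0 ≤ ξ) (h : ¬ (M.shift ξ).StrictlyPassive) :
    M.passivityMargin ν ≤ ENNReal.ofReal (ξ / 2) := by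
  rw [strictlyPassive_iff] at h
  push Not at h
  obtain ⟨v, hv, hobs⟩ := h
  have hvp := norm_toLp_pos hv
  set y : Fin n ⊕ Fin m → ℂ := Sum.elim (v ∘ Sum.inl) (-(v ∘ Sum.inr)) with hy
  have hny : ‖WithLp.toLp 2 y‖ = ‖WithLp.toLp 2 v‖ := by
    rw [EuclideanSpace.norm_eq, EuclideanSpace.norm_eq]
    simp [hy]
  set b := ‖WithLp.toLp 2 v‖
  -- The factor `1 / b²` cancels `vᴴ v`, so that `Δ` and the shift act on `v` alike; as `‖y‖ = ‖v‖`,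
  -- its size is at most `ξ / 2`.
  let Δ : StateSpace n m := ofMat (vecMulVec (((ξ / 2 / b ^ 2 : ℝ) : ℂ) • y) (star v))
  have hmat : (M + Δ).mat *ᵥ v = (M.shift ξ).mat *ᵥ v := by
    rw [mat_shift_mulVec, mat_add, add_mulVec, mat_ofMat, vecMulVec_mulVec,
      star_dotProduct_self_eq, op_smul_eq_smul, smul_smul, ← Complex.ofReal_mul]
    rw [show ‖WithLp.toLp 2 v‖ ^ 2 * (ξ / 2 / b ^ 2) = ξ / 2 from
      mul_div_cancel₀ _ (pow_pos hvp 2).ne']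
  refine (iInf₂_le Δ ?_).trans (ENNReal.ofReal_le_ofReal ?_)
  · rw [strictlyPassive_iff]
    push Not
    exact ⟨v, hv, hmat ▸ hobs⟩
  · refine (size_ofMat_vecMulVec_le ν _ _).trans (le_of_eq ?_)
    rw [WithLp.toLp_smul, norm_smul, Complex.norm_real, Real.norm_eq_abs,
      abs_of_nonneg (by positivity), hny]
    change ξ / 2 / b ^ 2 * b * b = _
    field_simp

end StateSpace

/-! ### Unitary matrices, and columns diagonalizing a skew relation `E Fᴴ + F Eᴴ = 0`. -/

namespace Matrix

variable {ι κ : Type*} [Fintype ι] [DecidableEq ι] [Fintype κ] [DecidableEq κ]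

/-- Two matrices with the same Gram matrix differ by a unitary factor. -/
lemma exists_unitary_mul_eq {P Q : Matrix ι κ ℂ} (h : Pᴴ * P = Qᴴ * Q) :
    ∃ U : Matrix ι ι ℂ, Uᴴ * U = 1 ∧ U * P = Q := by
  let f := toEuclideanLin (𝕜 := ℂ) P
  let g := toEuclideanLin (𝕜 := ℂ) Q
  have hsq : ∀ (R : Matrix ι κ ℂ) (x : EuclideanSpace ℂ κ),
      ((‖toEuclideanLin (𝕜 := ℂ) R x‖ ^ 2 : ℝ) : ℂ) = star x.ofLp ⬝ᵥ (Rᴴ * R) *ᵥ x.ofLp := by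
    intro R x
    rw [← mulVec_mulVec, dotProduct_mulVec, ← star_mulVec, star_dotProduct_self_eq]
    rfl
  have hn : ∀ x, ‖f x‖ = ‖g x‖ := by
    intro x
    have h1 := hsq P x
    rw [h, ← hsq Q x, Complex.ofReal_inj] at h1
    exact (sq_eq_sq₀ (norm_nonneg _) (norm_nonneg _)).1 h1
  obtain ⟨r, hr⟩ := f.rangeRestrict.exists_rightInverse_of_surjective f.range_rangeRestrict
  have hr' : ∀ y, f (r y) = y := fun y => congrArg Subtype.val (LinearMap.congr_fun hr y)
  -- The map `f x ↦ g x` is well defined and isometric on the range of `f`, by equality of the Gram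
  -- matrices, and extends to the whole space.
  let L : LinearMap.range f →ₗᵢ[ℂ] EuclideanSpace ℂ ι :=
    ⟨g.comp r, fun y => by
      change ‖g (r y)‖ = ‖y‖
      rw [← hn, hr']; rfl⟩
  have hL : ∀ x, L.extend (f x) = g x := by
    intro x
    have h1 := L.extend_apply (f.rangeRestrict x)
    have h2 : g (r (f.rangeRestrict x)) = g x := by
      rw [← sub_eq_zero, ← map_sub, ← norm_eq_zero, ← hn, map_sub, hr']
      simp
    exact h1.trans h2
  let U : Matrix ι ι ℂ := (toEuclideanLin (𝕜 := ℂ)).symm L.extend.toLinearMap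
  have hU : ∀ x : EuclideanSpace ℂ ι, U *ᵥ x.ofLp = (L.extend x).ofLp := by
    intro x
    have : toEuclideanLin (𝕜 := ℂ) U = L.extend.toLinearMap := by simp [U]
    have h2 := LinearMap.congr_fun this x
    exact congrArg WithLp.ofLp h2
  refine ⟨U, ?_, ?_⟩
  · have hiso : ∀ x y : EuclideanSpace ℂ ι,
        star x.ofLp ⬝ᵥ (Uᴴ * U) *ᵥ y.ofLp = star x.ofLp ⬝ᵥ y.ofLp := by
      intro x y
      rw [← mulVec_mulVec, dotProduct_mulVec, ← star_mulVec, hU, hU]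
      have := L.extend.inner_map_map x y
      rwa [EuclideanSpace.inner_eq_star_dotProduct, EuclideanSpace.inner_eq_star_dotProduct,
        dotProduct_comm, dotProduct_comm y.ofLp] at this
    ext i j
    have := hiso (EuclideanSpace.single i 1) (EuclideanSpace.single j 1)
    simpa [Matrix.one_apply, Pi.single_apply, eq_comm] using this
  · refine ext_of_mulVec_single fun j => ?_
    rw [← mulVec_mulVec]
    have := congrArg WithLp.ofLp (hL (WithLp.toLp 2 (Pi.single j 1)))
    rw [← hU] at this
    exact this

/-- The Cayley map embeds the real line in the unit circle, while the spectrum is finite. -/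
lemma exists_norm_eq_one_notMem_spectrum (U : Matrix ι ι ℂ) :
    ∃ z : ℂ, ‖z‖ = 1 ∧ z ∉ spectrum ℂ U := by
  let g : ℝ → ℂ := fun t => (t - Complex.I) / (t + Complex.I)
  have hne : ∀ t : ℝ, (t : ℂ) + Complex.I ≠ 0 := fun t h => by
    simpa using congrArg Complex.im h
  have hg : Function.Injective g := by
    intro s t hst
    simp only [g] at hst
    rw [div_eq_div_iff (hne s) (hne t)] at hst
    have := congrArg Complex.im hst
    simp at this
    linarith
  have hfin : (spectrum ℂ U).Finite := Matrix.finite_spectrum U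
  obtain ⟨t, ht⟩ := (hfin.preimage hg.injOn).exists_notMem
  refine ⟨g t, ?_, ht⟩
  rw [norm_div, div_eq_one_iff_eq (norm_ne_zero_iff.2 (hne t))]
  have : (t : ℂ) - Complex.I = (starRingEnd ℂ) (t + Complex.I) := by simp [sub_eq_add_neg]
  rw [this, Complex.norm_conj]

/-- A unitary matrix has an orthonormal basis of eigenvectors. -/
lemma exists_unitary_diagonalization {U : Matrix ι ι ℂ} (hU : Uᴴ * U = 1) :
    ∃ (V : Matrix ι ι ℂ) (μ : ι → ℂ), V * Vᴴ = 1 ∧ ∀ k, ‖μ k‖ = 1 ∧ U *ᵥ V.col k = μ k • V.col k := by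
  obtain ⟨z, hz, hzs⟩ := exists_norm_eq_one_notMem_spectrum U
  have hdet := isUnit_det_smul_one_sub hzs
  have hzz : star z * z = 1 := by
    have := Complex.normSq_eq_conj_mul_self (z := z)
    rw [Complex.normSq_eq_norm_sq, hz] at this
    simpa using this.symm
  have hzz' : z * star z = 1 := by rw [mul_comm, hzz]
  set R := z • (1 : Matrix ι ι ℂ) - U with hR
  set S := z • (1 : Matrix ι ι ℂ) + U with hS
  -- A Cayley transform of `U`, Hermitian because `U` is unitary; the Hermitian spectral theorem
  -- applies to it, and its eigenvectors are eigenvectors of `U`.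
  set K := Complex.I • (R⁻¹ * S) with hK
  have hRS : R * S = S * R := by
    simp only [hR, hS, Matrix.add_mul, Matrix.sub_mul, Matrix.mul_add, Matrix.mul_sub]; simp; abel
  have hRK : R * K = Complex.I • S := by
    rw [hK, Matrix.mul_smul, ← Matrix.mul_assoc, mul_nonsing_inv _ hdet, Matrix.one_mul]
  have hKR : K * R = Complex.I • S := by
    rw [hK, Matrix.smul_mul, Matrix.mul_assoc, ← hRS, ← Matrix.mul_assoc, nonsing_inv_mul _ hdet,
      Matrix.one_mul]
  have h1 : Rᴴ * S = star z • U - z • Uᴴ := by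
    simp only [hR, hS, conjTranspose_sub, conjTranspose_smul, conjTranspose_one,
      Matrix.sub_mul, Matrix.mul_add, Matrix.smul_mul, Matrix.mul_smul, Matrix.one_mul,
      Matrix.mul_one, hU, smul_sub, smul_smul, hzz', one_smul]
    abel
  have h2 : Sᴴ * R = z • Uᴴ - star z • U := by
    simp only [hR, hS, conjTranspose_add, conjTranspose_smul, conjTranspose_one,
      Matrix.add_mul, Matrix.mul_sub, Matrix.smul_mul, Matrix.mul_smul, Matrix.one_mul,
      Matrix.mul_one, hU, smul_add, smul_smul, hzz', one_smul]
    abel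
  have hskew : Rᴴ * (Complex.I • S) = (Complex.I • S)ᴴ * R := by
    rw [Matrix.mul_smul, h1, conjTranspose_smul, Matrix.smul_mul, h2, Complex.star_def,
      Complex.conj_I, neg_smul, ← smul_neg, neg_sub]
  have hKh : K.IsHermitian := by
    have h3 : Rᴴ * (K * R) = Rᴴ * (Kᴴ * R) := by
      rw [hKR, hskew, ← hKR, conjTranspose_mul, Matrix.mul_assoc]
    have hRu : IsUnit R := (isUnit_iff_isUnit_det _).2 hdet
    have hRu' : IsUnit Rᴴ := hRu.star
    exact (hRu.mul_right_cancel (hRu'.mul_left_cancel h3)).symm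
  have hI : ∀ t : ℝ, (t : ℂ) + Complex.I ≠ 0 := fun t h => by
    simpa using congrArg Complex.im h
  refine ⟨hKh.eigenvectorUnitary, fun k => z * (hKh.eigenvalues k - Complex.I) /
    (hKh.eigenvalues k + Complex.I), ?_, fun k => ⟨?_, ?_⟩⟩
  · exact mem_unitaryGroup_iff.1 hKh.eigenvectorUnitary.2
  · have h3 : (hKh.eigenvalues k : ℂ) - Complex.I =
        (starRingEnd ℂ) (hKh.eigenvalues k + Complex.I) := by simp [sub_eq_add_neg]
    rw [norm_div, norm_mul, hz, one_mul, h3, Complex.norm_conj,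
      div_self (norm_ne_zero_iff.2 (hI _))]
  · rw [hKh.eigenvectorUnitary_col_eq k]
    set v : ι → ℂ := ⇑(hKh.eigenvectorBasis k)
    set a : ℝ := hKh.eigenvalues k
    have hv : K *ᵥ v = (a : ℂ) • v := by
      rw [hKh.mulVec_eigenvectorBasis k]; rfl
    have h3 : R *ᵥ (K *ᵥ v) = (Complex.I • S) *ᵥ v := by rw [mulVec_mulVec, hRK]
    rw [hv, mulVec_smul, hR, hS, smul_mulVec, sub_mulVec, add_mulVec, smul_mulVec, one_mulVec] at h3
    have h4 : ((a : ℂ) + Complex.I) • (U *ᵥ v) = (z * (a - Complex.I)) • v := by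
      have : ((a : ℂ) + Complex.I) • (U *ᵥ v) - (z * (a - Complex.I)) • v =
        Complex.I • (z • v + U *ᵥ v) - (a : ℂ) • (z • v - U *ᵥ v) := by module
      rw [← sub_eq_zero, this, h3, sub_self]
    change _ = (z * (a - Complex.I) / (a + Complex.I)) • v
    rw [div_eq_inv_mul, mul_smul, ← h4, smul_smul, inv_mul_cancel₀ (hI a), one_smul]

/-- If the Hermitian part of `E Fᴴ` vanishes, then in a suitable orthonormal basis each column of
`E` is an imaginary multiple of the column of `F`, unless the latter is zero. -/
lemma exists_unitary_col_eq_smul {E F : Matrix κ ι ℂ} (h : E * Fᴴ + F * Eᴴ = 0) :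
    ∃ V : Matrix ι ι ℂ, V * Vᴴ = 1 ∧ ∀ k, F *ᵥ V.col k = 0 ∨
      ∃ ω : ℝ, E *ᵥ V.col k = (Complex.I * ω) • (F *ᵥ V.col k) := by
  -- The hypothesis says that `(E + F)(E + F)ᴴ = (E - F)(E - F)ᴴ`, so `E + F = (E - F)U` with `U`
  -- unitary; an eigenbasis of `U` decouples the columns.
  obtain ⟨U, hU, hEF⟩ := exists_unitary_mul_eq (P := (E + F)ᴴ) (Q := (E - F)ᴴ) (by
    simp only [conjTranspose_conjTranspose, conjTranspose_add, conjTranspose_sub, Matrix.add_mul,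
      Matrix.mul_add, Matrix.sub_mul, Matrix.mul_sub]
    rw [add_eq_zero_iff_eq_neg] at h
    rw [h]; abel)
  obtain ⟨V, μ, hV, hμ⟩ := exists_unitary_diagonalization hU
  have hEF' : (E - F) * U = E + F := by
    have := congrArg conjTranspose hEF
    rw [conjTranspose_mul, conjTranspose_conjTranspose, conjTranspose_conjTranspose] at this
    rw [← this, Matrix.mul_assoc, hU, Matrix.mul_one]
  refine ⟨V, hV, fun k => ?_⟩
  obtain ⟨hμ1, hμ2⟩ := hμ k
  have h1 : (E + F) *ᵥ V.col k = μ k • ((E - F) *ᵥ V.col k) := by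
    rw [← hEF', ← mulVec_mulVec, hμ2, mulVec_smul]
  rw [add_mulVec, sub_mulVec] at h1
  set e := E *ᵥ V.col k
  set f := F *ᵥ V.col k
  have h2 : (μ k - 1) • e = (μ k + 1) • f := by
    have : (μ k - 1) • e - (μ k + 1) • f = μ k • (e - f) - (e + f) := by module
    rw [← sub_eq_zero, this, h1, sub_self]
  -- The eigenvalue `1` corresponds to infinite frequency; any other unimodular `μ` gives the purely
  -- imaginary ratio `(μ + 1) / (μ - 1)`.
  by_cases hone : μ k = 1
  · left
    rw [hone, sub_self, zero_smul, eq_comm, smul_eq_zero] at h2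
    exact h2.resolve_left (by norm_num)
  · right
    have hne : μ k - 1 ≠ 0 := sub_ne_zero.2 hone
    set w := (μ k - 1)⁻¹ * (μ k + 1) with hw
    have hwre : w.re = 0 := by
      have h0 : μ k ≠ 0 := norm_ne_zero_iff.1 (by rw [hμ1]; norm_num)
      have hconj : (starRingEnd ℂ) (μ k) = (μ k)⁻¹ := (Complex.inv_eq_conj hμ1).symm
      have hne' : (μ k)⁻¹ - 1 ≠ 0 := sub_ne_zero.2 fun h => hone (by simpa using h)
      have : (starRingEnd ℂ) w = -w := by
        rw [hw, map_mul, map_inv₀, map_sub, map_add, map_one, hconj]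
        have hne'' : 1 - μ k ≠ 0 := sub_ne_zero.2 (Ne.symm hone)
        rw [← mul_right_inj' hne', ← mul_right_inj' hne]
        field_simp
        ring
      have := congrArg Complex.re this
      simp at this
      linarith
    refine ⟨w.im, ?_⟩
    have hwI : Complex.I * w.im = w := by
      apply Complex.ext <;> simp [hwre]
    rw [hwI, hw, mul_smul, ← h2, smul_smul, inv_mul_cancel₀ hne, one_smul]

end Matrix

/-! ### Separation from the positive definite cone, and Lyapunov's theorem. -/

namespace Matrix

variable {ι κ : Type*} [Fintype ι] [Fintype κ]

open scoped MatrixOrder in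
lemma PosSemidef.exists_eq_conjTranspose_mul_self {A : Matrix ι ι ℂ} (hA : A.PosSemidef) :
    ∃ B : Matrix ι ι ℂ, A = Bᴴ * B := by
  classical
  exact CStarAlgebra.nonneg_iff_eq_star_mul_self.mp hA.nonneg

lemma re_trace_mul_vecMulVec (Z : Matrix ι ι ℂ) (v : ι → ℂ) :
    (Z * vecMulVec v (star v)).trace.re = Z.reQuad v := by
  rw [mul_vecMulVec, trace_vecMulVec, dotProduct_comm]; rfl

lemma re_trace_conjTranspose_mul {N : Matrix ι ι ℂ} (hN : N.IsHermitian) (Z : Matrix ι ι ℂ) :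
    (Zᴴ * N).trace.re = (Z * N).trace.re := by
  have : (Zᴴ * N).trace = star (Z * N).trace := by
    rw [← trace_conjTranspose, conjTranspose_mul, hN, trace_mul_comm]
  rw [this]; simp

/-- `L Lᴴ` is unchanged when `L` is replaced by `L V`; this freedom lets the columns be adapted to
the model later. -/
lemma re_trace_mul_conjTranspose_mul [DecidableEq ι] [DecidableEq κ] (L : Matrix ι κ ℂ)
    (H : Matrix ι ι ℂ) {V : Matrix κ κ ℂ} (hV : V * Vᴴ = 1) :
    (L * Lᴴ * H).trace.re = ∑ k, H.reQuad (L *ᵥ V.col k) := by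
  have h1 : (L * Lᴴ * H).trace = ((L * V)ᴴ * H * (L * V)).trace := by
    have h2 : L * Lᴴ = L * V * (L * V)ᴴ := by
      rw [conjTranspose_mul, Matrix.mul_assoc, ← Matrix.mul_assoc V, hV, Matrix.one_mul]
    rw [h2, Matrix.mul_assoc, trace_mul_comm]
  rw [h1, trace, Complex.re_sum]
  refine Finset.sum_congr rfl fun k _ => ?_
  have h2 : L *ᵥ V.col k = (L * V) *ᵥ Pi.single k 1 := by
    rw [← mulVec_mulVec, mulVec_single_one]
  rw [h2, ← reQuad_mul_mul, reQuad, mulVec_single_one, Pi.star_single, star_one,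
    single_one_dotProduct]
  rfl

/-- Separation of a convex set of Hermitian matrices from the positive definite cone. -/
theorem exists_posSemidef_of_forall_not_posDef {t : Set (Matrix ι ι ℂ)} (ht : Convex ℝ t)
    (hne : t.Nonempty) (hherm : ∀ H ∈ t, H.IsHermitian) (hnot : ∀ H ∈ t, ¬ H.PosDef) :
    ∃ Z : Matrix ι ι ℂ, Z.PosSemidef ∧ Z ≠ 0 ∧ ∀ H ∈ t, (Z * H).trace.re ≤ 0 := by
  classical
  let s : Set (Matrix ι ι ℂ) := {H | ∀ v, v ≠ 0 → 0 < H.reQuad v}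
  have hs : Convex ℝ s := by
    intro H hH K hK a b ha hb hab v hv
    rw [reQuad_add, reQuad_smul, reQuad_smul]
    rcases ha.eq_or_lt with rfl | ha
    · have : b = 1 := by linarith
      subst this
      simpa using hK v hv
    · exact add_pos_of_pos_of_nonneg (mul_pos ha (hH v hv)) (mul_nonneg hb (hK v hv).le)
  have hdisj : Disjoint s t := Set.disjoint_left.2 fun H hH hHt =>
    hnot H hHt ((hherm H hHt).posDef_iff_reQuad.2 hH)
  obtain ⟨f, u, hfs, hft⟩ := RCLike.geometric_hahn_banach_open (𝕜 := ℂ) hs isOpen_setOf_reQuad_pos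
    ht hdisj
  simp only [RCLike.re_eq_complex_re] at hfs hft
  have hsmul : ∀ (r : ℝ) (N : Matrix ι ι ℂ), (f (r • N)).re = r * (f N).re := by
    intro r N
    have : r • N = (r : ℂ) • N := by ext; simp
    rw [this, map_smul, smul_eq_mul, Complex.re_ofReal_mul]
  have hcone : ∀ N ∈ s, ∀ r : ℝ, 0 < r → r • N ∈ s := by
    intro N hN r hr v hv
    rw [reQuad_smul]
    exact mul_pos hr (hN v hv)
  have hone : (1 : Matrix ι ι ℂ) ∈ s := fun v hv => by
    rw [reQuad_one]; exact pow_pos (norm_toLp_pos hv) 2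
  have hu : 0 ≤ u := by
    by_contra! hneg
    have h1 := hfs _ (hcone _ hone (-u / (|(f 1).re| + 1))
      (div_pos (by linarith) (by positivity)))
    rw [hsmul, div_mul_eq_mul_div, div_lt_iff₀ (by positivity)] at h1
    nlinarith [neg_abs_le (f 1).re]
  have hs0 : ∀ N ∈ s, (f N).re ≤ 0 := by
    intro N hN
    by_contra! hpos
    have h1 := hfs _ (hcone _ hN ((u + 1) / (f N).re) (by positivity))
    rw [hsmul, div_mul_cancel₀ _ hpos.ne'] at h1
    linarith
  -- Represents `-f` through the trace pairing. On Hermitian matrices only the Hermitian part of `Y`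
  -- contributes to the real part.
  let Y : Matrix ι ι ℂ := fun i j => -f (single j i 1)
  have hY : ∀ N, (Y * N).trace = -f N := by
    intro N
    conv_rhs => rw [matrix_eq_sum_single N]
    simp only [trace, diag_apply, Y, map_sum]
    rw [Finset.sum_comm, ← Finset.sum_neg_distrib]
    refine Finset.sum_congr rfl fun i _ => ?_
    rw [← Finset.sum_neg_distrib]
    refine Finset.sum_congr rfl fun j _ => ?_
    have : single j i (N j i) = N j i • single j i (1 : ℂ) := by simp
    change -f (single j i 1) * N j i = _
    rw [this, map_smul, smul_eq_mul]
    ring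
  have hZ : ∀ N : Matrix ι ι ℂ, N.IsHermitian → ((Yᴴ + Y) * N).trace.re = -(2 * (f N).re) := by
    intro N hN
    rw [Matrix.add_mul, trace_add, Complex.add_re, re_trace_conjTranspose_mul hN, hY]
    simp; ring
  have hherm' : (Yᴴ + Y).IsHermitian := by
    rw [IsHermitian, conjTranspose_add, conjTranspose_conjTranspose, add_comm]
  refine ⟨Yᴴ + Y, hherm'.posSemidef_iff_reQuad.2 fun v => ?_, ?_, fun H hH => ?_⟩
  · rw [← re_trace_mul_vecMulVec, hZ _ (posSemidef_vecMulVec_self_star v).1]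
    -- Rank one matrices lie only on the boundary of the cone, so they are approached by adding `ε
    -- I`.
    have hle : ∀ ε : ℝ, 0 < ε → (f (vecMulVec v (star v))).re ≤ ε * -(f 1).re := by
      intro ε hε
      have h1 := hs0 (vecMulVec v (star v) + ε • 1) (fun w hw => by
        rw [reQuad_add]
        exact add_pos_of_nonneg_of_pos ((posSemidef_vecMulVec_self_star v).reQuad_nonneg w)
          (hcone _ hone ε hε w hw))
      rw [map_add, Complex.add_re, hsmul] at h1
      linarith
    have h2 : (f (vecMulVec v (star v))).re ≤ 0 := by
      by_contra! hpos
      have h3 := hle ((f (vecMulVec v (star v))).re / (2 * (|(f 1).re| + 1))) (by positivity)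
      rw [div_mul_eq_mul_div, le_div_iff₀ (by positivity)] at h3
      nlinarith [neg_abs_le (f 1).re, abs_nonneg (f 1).re]
    linarith
  · intro h0
    obtain ⟨H, hH⟩ := hne
    have h1 := hZ 1 isHermitian_one
    have h2 := hZ H (hherm H hH)
    rw [h0, Matrix.zero_mul, trace_zero, Complex.zero_re] at h1 h2
    linarith [hfs 1 hone, hft H hH]
  · rw [hZ H (hherm H hH)]
    linarith [hft H hH]

section Stable

attribute [local instance] Matrix.linftyOpNormedRing Matrix.linftyOpNormedAlgebra

/-- Gelfand's formula turns spectral radius below `1` into geometric decay. -/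
lemma tendsto_pow_mulVec_of_spectrum_norm_lt_one [DecidableEq ι] {S : Matrix ι ι ℂ}
    (hS : ∀ μ ∈ spectrum ℂ S, ‖μ‖ < 1) (w : ι → ℂ) :
    Filter.Tendsto (fun k : ℕ => S ^ k *ᵥ w) Filter.atTop (nhds 0) := by
  cases isEmpty_or_nonempty ι
  · exact tendsto_const_nhds.congr fun k => Subsingleton.elim _ _
  have : CompleteSpace (Matrix ι ι ℂ) := FiniteDimensional.complete ℂ _
  have hr : spectralRadius ℂ S < (1 : NNReal) :=
    spectrum.spectralRadius_lt_of_forall_lt S fun z hz => hS z hz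
  obtain ⟨r, hr1, hr2⟩ := ENNReal.lt_iff_exists_nnreal_btwn.1 hr
  have hev := (spectrum.pow_nnnorm_pow_one_div_tendsto_nhds_spectralRadius S).eventually_lt_const hr1
  have hr2' : r < 1 := by exact_mod_cast hr2
  have hpow : Filter.Tendsto (fun k : ℕ => (r : ℝ) ^ k * ‖w‖) Filter.atTop (nhds 0) := by
    simpa using (tendsto_pow_atTop_nhds_zero_of_lt_one r.2 hr2').mul_const ‖w‖
  refine squeeze_zero_norm' ?_ hpow
  filter_upwards [hev, Filter.eventually_gt_atTop 0] with k hk hk0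
  refine (linfty_opNorm_mulVec _ _).trans (mul_le_mul_of_nonneg_right ?_ (norm_nonneg _))
  have hk' : (0 : ℝ) < k := by exact_mod_cast hk0
  have h1 := ENNReal.rpow_lt_rpow hk hk'
  rw [← ENNReal.rpow_mul, one_div, inv_mul_cancel₀ hk'.ne', ENNReal.rpow_one,
    ENNReal.rpow_natCast, ← ENNReal.coe_pow, ENNReal.coe_lt_coe] at h1
  exact_mod_cast h1.le

end Stable

/-- Lyapunov's theorem. -/
theorem posDef_of_lyapunov [DecidableEq ι] {A X : Matrix ι ι ℂ} (hA : ∀ z ∈ spectrum ℂ A, z.re < 0)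
    (hX : X.IsHermitian) (hL : (-(Aᴴ * X) - X * A).PosDef) : X.PosDef := by
  have hdet : IsUnit (1 - A).det := by
    have := isUnit_det_smul_one_sub (A := A) (z := 1)
      (fun h => absurd (hA 1 h) (by simp))
    rwa [one_smul] at this
  -- The Cayley transform maps the open left half plane into the open unit disc and turns the
  -- Lyapunov inequality into strict decrease of the `X`-form under `S`. As `Sᵏ w → 0`, the form is
  -- nonnegative at `w`.
  set S := (1 + A) * (1 - A)⁻¹ with hS
  have hfac : ∀ w, ∃ y, w = y - A *ᵥ y ∧ S *ᵥ w = y + A *ᵥ y := by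
    intro w
    have h : w = (1 - A) *ᵥ ((1 - A)⁻¹ *ᵥ w) := by
      rw [mulVec_mulVec, mul_nonsing_inv _ hdet, one_mulVec]
    refine ⟨(1 - A)⁻¹ *ᵥ w, ?_, ?_⟩
    · conv_lhs => rw [h]
      rw [sub_mulVec, one_mulVec]
    · rw [hS, ← mulVec_mulVec, add_mulVec, one_mulVec]
  have hspec : ∀ μ ∈ spectrum ℂ S, ‖μ‖ < 1 := by
    intro μ hμ
    obtain ⟨w, hw0, hw⟩ := (mem_spectrum_iff_exists_mulVec _ _).1 hμ
    obtain ⟨y, hy1, hy2⟩ := hfac w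
    rw [hw, hy1] at hy2
    have hy0 : y ≠ 0 := by
      rintro rfl
      exact hw0 (by simpa using hy1)
    have hAy : (μ + 1) • (A *ᵥ y) = (μ - 1) • y := by
      have : (μ + 1) • (A *ᵥ y) - (μ - 1) • y = (y + A *ᵥ y) - μ • (y - A *ᵥ y) := by module
      rw [← sub_eq_zero, this, hy2, sub_self]
    have hne : μ + 1 ≠ 0 := by
      intro h0
      have hμ1 : μ = -1 := eq_neg_of_add_eq_zero_left h0
      rw [h0, zero_smul, hμ1, eq_comm, smul_eq_zero] at hAy
      exact hAy.elim (by norm_num) hy0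
    have hmem := (mem_spectrum_iff_exists_mulVec A ((μ + 1)⁻¹ * (μ - 1))).2 ⟨y, hy0, by
      rw [mul_smul, ← hAy, smul_smul, inv_mul_cancel₀ hne, one_smul]⟩
    have hre := hA _ hmem
    rw [show (μ + 1)⁻¹ * (μ - 1) =
        ((Complex.normSq (μ + 1))⁻¹ : ℝ) * ((starRingEnd ℂ) (μ + 1) * (μ - 1)) by
      rw [Complex.inv_def]; ring, Complex.re_ofReal_mul] at hre
    have hpos : 0 < (Complex.normSq (μ + 1))⁻¹ := inv_pos.2 (Complex.normSq_pos.2 hne)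
    have h2 := neg_of_mul_neg_right hre hpos.le
    simp at h2
    have h3 : ‖μ‖ ^ 2 < 1 := by
      rw [← Complex.normSq_eq_norm_sq, Complex.normSq_apply]
      nlinarith
    exact (sq_lt_one_iff₀ (norm_nonneg μ)).1 h3
  have hdec : ∀ w, w ≠ 0 → X.reQuad (S *ᵥ w) < X.reQuad w := by
    intro w hw0
    obtain ⟨y, hy1, hy2⟩ := hfac w
    have hy0 : y ≠ 0 := by
      rintro rfl
      exact hw0 (by simpa using hy1)
    have h1 := hL.reQuad_pos hy0
    have h2 : (-(Aᴴ * X) - X * A).reQuad y =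
        -(2 * (star y ⬝ᵥ X *ᵥ (A *ᵥ y)).re) := by
      have h3 : -(Aᴴ * X) - X * A = -((1 : ℝ) • ((X * A)ᴴ + X * A)) := by
        rw [conjTranspose_mul, hX, one_smul]; abel
      rw [h3, ← neg_smul, reQuad_smul, reQuad_add, reQuad_conjTranspose, reQuad, ← mulVec_mulVec]
      ring
    have h3 : (star (A *ᵥ y) ⬝ᵥ X *ᵥ y).re = (star y ⬝ᵥ X *ᵥ (A *ᵥ y)).re := by
      have : star (A *ᵥ y) ⬝ᵥ X *ᵥ y = star (star y ⬝ᵥ X *ᵥ (A *ᵥ y)) := by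
        rw [star_dotProduct, star_mulVec, hX, ← dotProduct_mulVec]
      rw [this]; simp
    rw [hy2, hy1]
    simp only [reQuad, star_add, star_sub, mulVec_add, mulVec_sub, dotProduct_add, dotProduct_sub,
      add_dotProduct, sub_dotProduct, Complex.add_re, Complex.sub_re]
    linarith
  have hnn : ∀ w, 0 ≤ X.reQuad w := by
    intro w
    have hlim : Filter.Tendsto (fun k : ℕ => X.reQuad (S ^ k *ᵥ w)) Filter.atTop (nhds 0) := by
      have h1 := (continuous_reQuad.comp (by fun_prop :
        Continuous fun v : ι → ℂ => (X, v))).continuousAt.tendsto.comp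
        (tendsto_pow_mulVec_of_spectrum_norm_lt_one hspec w)
      simpa [Function.comp_def, reQuad] using h1
    have hanti : Antitone fun k : ℕ => X.reQuad (S ^ k *ᵥ w) := by
      refine antitone_nat_of_succ_le fun k => ?_
      rw [pow_succ', ← mulVec_mulVec]
      by_cases h0 : S ^ k *ᵥ w = 0
      · rw [h0, mulVec_zero]
      · exact (hdec _ h0).le
    simpa using hanti.le_of_tendsto hlim 0
  exact hX.posDef_iff_reQuad.2 fun w hw => (hnn _).trans_lt (hdec w hw)

end Matrix

/-! ### The strict Kalman-Yakubovich-Popov lemma. -/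

namespace StateSpace

variable {n m k : ℕ}

lemma W_combo (M : StateSpace n m) (X Y : Matrix (Fin n) (Fin n) ℂ) {a b : ℝ} (hab : a + b = 1) :
    M.W (a • X + b • Y) = a • M.W X + b • M.W Y := by
  have h : ∀ {k l : ℕ} (N P : Matrix (Fin k) (Fin l) ℂ),
      N - P = a • (N - P) + b • (N - P) := by
    intro k l N P
    rw [← add_smul, hab, one_smul]
  rw [W, W, W, fromBlocks_smul, fromBlocks_smul, fromBlocks_add]
  congr 1
  · simp only [Matrix.mul_add, Matrix.add_mul, Matrix.mul_smul, Matrix.smul_mul]; module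
  · simp only [Matrix.add_mul, Matrix.smul_mul]
    conv_lhs => rw [← one_smul ℝ M.Cᴴ, ← hab]
    module
  · simp only [Matrix.mul_add, Matrix.mul_smul]
    conv_lhs => rw [← one_smul ℝ M.C, ← hab]
    module
  · rw [← add_smul, hab, one_smul]

lemma inl_W (M : StateSpace n m) (X : Matrix (Fin n) (Fin n) ℂ) :
    (M.W X).submatrix Sum.inl Sum.inl = -(M.Aᴴ * X) - X * M.A := rfl

/-- The strict Kalman-Yakubovich-Popov lemma. -/
theorem StrictlyPassive.exists_W_posDef {M : StateSpace n m} (h : M.StrictlyPassive) :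
    ∃ X : Matrix (Fin n) (Fin n) ℂ, X.PosDef ∧ (M.W X).PosDef := by
  suffices hH : ∃ X : Matrix (Fin n) (Fin n) ℂ, X.IsHermitian ∧ (M.W X).PosDef by
    obtain ⟨X, hX, hW⟩ := hH
    exact ⟨X, posDef_of_lyapunov h.1 hX
      (inl_W M X ▸ hW.submatrix Sum.inl_injective), hW⟩
  by_contra! hno
  let t := {H | ∃ X : Matrix (Fin n) (Fin n) ℂ, X.IsHermitian ∧ M.W X = H}
  have ht : Convex ℝ t := by
    rintro _ ⟨X, hX, rfl⟩ _ ⟨Y, hY, rfl⟩ a b - - hab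
    refine ⟨a • X + b • Y, ?_, W_combo M X Y hab⟩
    rw [IsHermitian, conjTranspose_add, conjTranspose_smul, conjTranspose_smul, hX, hY]
    simp
  obtain ⟨Z, hZ, hZ0, hZt⟩ := exists_posSemidef_of_forall_not_posDef ht
    ⟨_, 0, isHermitian_zero, rfl⟩ (by rintro _ ⟨X, hX, rfl⟩; exact M.W_isHermitian hX)
    (by rintro _ ⟨X, hX, rfl⟩; exact hno X hX)
  obtain ⟨B, rfl⟩ := hZ.exists_eq_conjTranspose_mul_self
  set L := Bᴴ with hL
  have hB : B = Lᴴ := by simp [hL]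
  rw [hB] at hZt hZ0
  -- The columns of `F` and `E` are the states and state derivatives belonging to the columns of
  -- `L`, where `Z = L Lᴴ` is the separating matrix.
  set F := L.submatrix (Sum.inl : Fin n → Fin n ⊕ Fin m) id with hF
  set E := (M.mat * L).submatrix (Sum.inl : Fin n → Fin n ⊕ Fin m) id with hE
  have hFv : ∀ w, F *ᵥ w = (L *ᵥ w) ∘ Sum.inl := fun w => rfl
  have hEv : ∀ w, E *ᵥ w = (M.mat *ᵥ (L *ᵥ w)) ∘ Sum.inl := fun w => by
    rw [mulVec_mulVec]; rfl
  have hsum : ∀ {V : Matrix (Fin n ⊕ Fin m) (Fin n ⊕ Fin m) ℂ}, V * Vᴴ = 1 →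
      ∀ X : Matrix (Fin n) (Fin n) ℂ, X.IsHermitian →
      ∑ k, (M.W X).reQuad (L *ᵥ V.col k) ≤ 0 := by
    intro V hV X hX
    rw [← re_trace_mul_conjTranspose_mul L _ hV]
    exact hZt _ ⟨X, hX, rfl⟩
  set c : ℝ := ∑ k, (star ((L *ᵥ (1 : Matrix (Fin n ⊕ Fin m) (Fin n ⊕ Fin m) ℂ).col k) ∘ Sum.inr) ⬝ᵥ
    ((M.mat *ᵥ (L *ᵥ (1 : Matrix (Fin n ⊕ Fin m) (Fin n ⊕ Fin m) ℂ).col k)) ∘ Sum.inr)).re with hc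
  -- A real linear functional of `X` that is bounded below on all Hermitian matrices vanishes;
  -- tested on large negative multiples of `G + Gᴴ`, this yields the skew relation below.
  have hG : ∀ X : Matrix (Fin n) (Fin n) ℂ, X.IsHermitian → c ≤ (X * (E * Fᴴ)).trace.re := by
    intro X hX
    have h1 := hsum (V := 1) (by simp) X hX
    simp only [M.reQuad_W hX] at h1
    rw [← Finset.mul_sum, Finset.sum_sub_distrib, ← hc] at h1
    have h2 : (X * (E * Fᴴ)).trace.re = ∑ k,
        (star ((L *ᵥ (1 : Matrix (Fin n ⊕ Fin m) (Fin n ⊕ Fin m) ℂ).col k) ∘ Sum.inl) ⬝ᵥ X *ᵥ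
        ((M.mat *ᵥ (L *ᵥ (1 : Matrix (Fin n ⊕ Fin m) (Fin n ⊕ Fin m) ℂ).col k)) ∘ Sum.inl)).re := by
      rw [← Matrix.mul_assoc, trace_mul_comm, trace, Complex.re_sum]
      refine Finset.sum_congr rfl fun k _ => ?_
      rw [← hFv, ← hEv]
      have hcol : (1 : Matrix (Fin n ⊕ Fin m) (Fin n ⊕ Fin m) ℂ).col k = Pi.single k 1 := by
        ext i; simp [Matrix.one_apply, Pi.single_apply]
      rw [hcol, mulVec_single_one, mulVec_single_one]
      rfl
    linarith
  have hskew : E * Fᴴ + F * Eᴴ = 0 := by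
    set G := E * Fᴴ with hGdef
    have hGh : F * Eᴴ = Gᴴ := by rw [hGdef, conjTranspose_mul, conjTranspose_conjTranspose]
    rw [hGh]
    have hYh : (G + Gᴴ).IsHermitian := by
      rw [IsHermitian, conjTranspose_add, conjTranspose_conjTranspose, add_comm]
    have hpsd := posSemidef_conjTranspose_mul_self (G + Gᴴ)
    have htr : ((G + Gᴴ)ᴴ * (G + Gᴴ)).trace.re = 2 * ((G + Gᴴ) * G).trace.re := by
      rw [hYh.eq, trace_mul_comm]
      nth_rw 1 [Matrix.add_mul]
      rw [trace_add, Complex.add_re, re_trace_conjTranspose_mul hYh, trace_mul_comm]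
      ring
    have htr0 : ((G + Gᴴ)ᴴ * (G + Gᴴ)).trace.re ≤ 0 := by
      rw [htr]
      by_contra! hpos
      have hpos' : 0 < ((G + Gᴴ) * G).trace.re := by linarith
      have h1 := hG ((-((|c| + 1) / ((G + Gᴴ) * G).trace.re)) • (G + Gᴴ)) (by
        rw [IsHermitian, conjTranspose_smul, hYh]; simp)
      rw [Matrix.smul_mul, trace_smul, Complex.real_smul, Complex.re_ofReal_mul, neg_mul,
        div_mul_cancel₀ _ hpos'.ne'] at h1
      linarith [neg_abs_le c]
    have htrn := hpsd.trace_nonneg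
    have h0 : ((G + Gᴴ)ᴴ * (G + Gᴴ)).trace = 0 := by
      rw [Complex.le_def] at htrn
      exact Complex.ext (le_antisymm htr0 htrn.1) htrn.2.symm
    exact trace_conjTranspose_mul_self_eq_zero_iff.1 h0
  obtain ⟨V, hV, hcol⟩ := exists_unitary_col_eq_smul hskew
  have hle := hsum hV 0 isHermitian_zero
  rw [strictlyPassive_iff] at h
  -- Every rotated column sits at a single frequency, finite or infinite, so strict passivity makes
  -- its contribution positive unless it is zero. The sum is at most `0`, which forces `L = 0`.
  have hpos : ∀ k, L *ᵥ V.col k ≠ 0 → 0 < (M.W 0).reQuad (L *ᵥ V.col k) := by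
    intro k hk
    have hobs := h _ hk
    rw [M.reQuad_W isHermitian_zero]
    simp only [zero_mulVec, dotProduct_zero, Complex.zero_re, sub_zero]
    by_contra! hneg
    refine hobs (Or.inr ?_)
    rcases hcol k with h0 | ⟨ω, hω⟩
    · exact Or.inr ⟨h0, by linarith⟩
    · exact Or.inl ⟨ω, by rw [← hEv, hω, hFv], by linarith⟩
  have hnn : ∀ k, 0 ≤ (M.W 0).reQuad (L *ᵥ V.col k) := by
    intro k
    by_cases hk : L *ᵥ V.col k = 0
    · simp [hk, reQuad]
    · exact (hpos k hk).le
  have hall : ∀ k, L *ᵥ V.col k = 0 := by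
    intro k
    by_contra hk
    have := Finset.single_le_sum (fun i _ => hnn i) (Finset.mem_univ k)
    linarith [hpos k hk]
  have hLV : L * V = 0 := by
    ext i k
    exact congrFun (hall k) i
  have hL0 : L = 0 := by
    rw [← Matrix.mul_one L, ← hV, ← Matrix.mul_assoc, hLV, Matrix.zero_mul]
  exact hZ0 (by rw [hL0, Matrix.zero_mul])


/-! ### Controllability, observability and compactness of the solution set. -/

lemma Controllable.exists_right_inverse {A : Matrix (Fin n) (Fin n) ℂ} {B : Matrix (Fin n) (Fin m) ℂ}
    (h : Controllable A B) (s : ℂ) : ∃ (P : Matrix (Fin n) (Fin n) ℂ) (Q : Matrix (Fin m) (Fin n) ℂ),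
      (s • (1 : Matrix (Fin n) (Fin n) ℂ) - A) * P + B * Q = 1 := by
  have hsurj : Function.Surjective
      (fromCols (s • (1 : Matrix (Fin n) (Fin n) ℂ) - A) B).mulVec := by
    have h1 : LinearMap.range (fromCols (s • (1 : Matrix (Fin n) (Fin n) ℂ) - A) B).mulVecLin = ⊤ :=
      Submodule.eq_top_of_finrank_eq (by simpa [Matrix.rank] using h s)
    exact LinearMap.range_eq_top.1 h1
  obtain ⟨R, hR⟩ := mulVec_surjective_iff_exists_right_inverse.1 hsurj
  refine ⟨R.toRows₁, R.toRows₂, ?_⟩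
  rw [← fromCols_mul_fromRows, fromRows_toRows, hR]

lemma exists_left_inverse_of_controllable {A : Matrix (Fin n) (Fin n) ℂ}
    {C : Matrix (Fin m) (Fin n) ℂ} (h : Controllable Aᴴ Cᴴ) (s : ℂ) :
    ∃ (P : Matrix (Fin n) (Fin n) ℂ) (Q : Matrix (Fin n) (Fin m) ℂ),
      P * (s • (1 : Matrix (Fin n) (Fin n) ℂ) - A) + Q * C = 1 := by
  obtain ⟨P, Q, hPQ⟩ := h.exists_right_inverse (star s)
  refine ⟨Pᴴ, Qᴴ, ?_⟩
  have := congrArg conjTranspose hPQ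
  simpa [conjTranspose_mul] using this

/-- An invariant subspace that contains the range of `B` is everything. -/
lemma Controllable.eq_top {A : Matrix (Fin n) (Fin n) ℂ} {B : Matrix (Fin n) (Fin m) ℂ}
    (h : Controllable A B) (K : Submodule ℂ (Fin n → ℂ)) (hA : ∀ x ∈ K, A *ᵥ x ∈ K)
    (hB : ∀ u, B *ᵥ u ∈ K) : K = ⊤ := by
  by_contra hK
  have hnt : Nontrivial ((Fin n → ℂ) ⧸ K) := Submodule.Quotient.nontrivial_iff.2 hK
  let f : Module.End ℂ ((Fin n → ℂ) ⧸ K) := K.mapQ K A.mulVecLin hA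
  obtain ⟨s, hs⟩ := Module.End.exists_eigenvalue f
  obtain ⟨P, Q, hPQ⟩ := h.exists_right_inverse s
  -- Modulo `K` the term `B Q` disappears from `(s - A)P + B Q = 1`, so `s - A` is onto the
  -- quotient, hence injective there, although `s` is an eigenvalue.
  have hsurj : Function.Surjective (algebraMap ℂ (Module.End ℂ ((Fin n → ℂ) ⧸ K)) s - f) := by
    intro y
    obtain ⟨x, rfl⟩ := Submodule.Quotient.mk_surjective K y
    refine ⟨Submodule.Quotient.mk (P *ᵥ x), ?_⟩
    have h1 : x = (s • (P *ᵥ x) - A *ᵥ (P *ᵥ x)) + B *ᵥ (Q *ᵥ x) := by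
      conv_lhs => rw [← one_mulVec x, ← hPQ, add_mulVec, ← mulVec_mulVec, ← mulVec_mulVec,
        sub_mulVec, smul_mulVec, one_mulVec]
    have h2 : (Submodule.Quotient.mk (B *ᵥ (Q *ᵥ x)) : (Fin n → ℂ) ⧸ K) = 0 :=
      (Submodule.Quotient.mk_eq_zero K).2 (hB _)
    conv_rhs => rw [h1, Submodule.Quotient.mk_add, h2, add_zero]
    rfl
  have hinj := LinearMap.injective_iff_surjective.2 hsurj
  obtain ⟨v, hv⟩ := hs.exists_hasEigenvector
  refine hv.2 (hinj ?_)
  rw [map_zero, LinearMap.sub_apply, hv.apply_eq_smul]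
  simp [Module.algebraMap_end_apply]

/-- An invariant subspace that `C` annihilates is zero. -/
lemma eq_bot_of_controllable {A : Matrix (Fin n) (Fin n) ℂ} {C : Matrix (Fin m) (Fin n) ℂ}
    (h : Controllable Aᴴ Cᴴ) (K : Submodule ℂ (Fin n → ℂ)) (hA : ∀ x ∈ K, A *ᵥ x ∈ K)
    (hC : ∀ x ∈ K, C *ᵥ x = 0) : K = ⊥ := by
  by_contra hK
  have hnt : Nontrivial K := Submodule.nontrivial_iff_ne_bot.2 hK
  let f : Module.End ℂ K := A.mulVecLin.restrict hA
  obtain ⟨s, hs⟩ := Module.End.exists_eigenvalue f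
  obtain ⟨P, Q, hPQ⟩ := exists_left_inverse_of_controllable h s
  obtain ⟨v, hv⟩ := hs.exists_hasEigenvector
  have hAv : A *ᵥ (v : Fin n → ℂ) = s • (v : Fin n → ℂ) := congrArg Subtype.val hv.apply_eq_smul
  refine hv.2 (Subtype.ext ?_)
  change (v : Fin n → ℂ) = 0
  rw [← one_mulVec (v : Fin n → ℂ), ← hPQ, add_mulVec, ← mulVec_mulVec, ← mulVec_mulVec,
    hC v v.2, sub_mulVec, smul_mulVec, one_mulVec, hAv, sub_self, mulVec_zero, mulVec_zero,
    add_zero]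

/-- The semidefinite Lyapunov matrix has zero form at `q`, hence annihilates `q`. In effect the
kernel of `X` is `A`-invariant. -/
lemma mulVec_mulVec_eq_zero_of_lyapunov {A X : Matrix (Fin n) (Fin n) ℂ} (hX : X.IsHermitian)
    (hL : (-(Aᴴ * X) - X * A).PosSemidef) {q : Fin n → ℂ} (hq : X *ᵥ q = 0) :
    X *ᵥ (A *ᵥ q) = 0 := by
  have h0 : (-(Aᴴ * X) - X * A) *ᵥ q = -(X *ᵥ (A *ᵥ q)) := by
    rw [sub_mulVec, neg_mulVec, ← mulVec_mulVec, ← mulVec_mulVec, hq, mulVec_zero, neg_zero,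
      zero_sub]
  have h1 : (-(Aᴴ * X) - X * A).reQuad q = 0 := by
    rw [reQuad, h0, dotProduct_neg, dotProduct_mulVec]
    have : star q ᵥ* X = star (X *ᵥ q) := by rw [star_mulVec, hX]
    rw [this, hq]; simp
  have h2 := hL.mulVec_eq_zero h1
  rwa [h0, neg_eq_zero] at h2

lemma W_lyapunov_posSemidef {M : StateSpace n m} {X : Matrix (Fin n) (Fin n) ℂ}
    (hW : (M.W X).PosSemidef) : (-(M.Aᴴ * X) - X * M.A).PosSemidef :=
  inl_W M X ▸ hW.submatrix Sum.inl

/-- For an observable model the nonnegative solutions of the inequality are definite. -/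
lemma posDef_of_W_posSemidef {M : StateSpace n m} (hM : Controllable M.Aᴴ M.Cᴴ)
    {X : Matrix (Fin n) (Fin n) ℂ} (hX : X.PosSemidef) (hW : (M.W X).PosSemidef) : X.PosDef := by
  refine hX.posDef_of_det_ne_zero fun hdet => ?_
  obtain ⟨q, hq0, hq⟩ := exists_mulVec_eq_zero_iff.2 hdet
  have hbot := eq_bot_of_controllable hM (LinearMap.ker X.mulVecLin)
    (fun x hx => mulVec_mulVec_eq_zero_of_lyapunov hX.1 (W_lyapunov_posSemidef hW) hx) (by
      intro x hx
      have hx' : X *ᵥ x = 0 := hx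
      have h1 : (M.W X).reQuad (Sum.elim x 0) = 0 := by
        rw [M.reQuad_W hX.1]
        have h2 : star x ᵥ* X = star (X *ᵥ x) := by rw [star_mulVec, hX.1]
        simp [dotProduct_mulVec, h2, hx']
      have h3 := congrArg (· ∘ Sum.inr) (hW.mulVec_eq_zero h1)
      simpa [W, fromBlocks_mulVec, sub_mulVec, ← mulVec_mulVec, hx'] using h3)
  exact hq0 ((Submodule.mem_bot ℂ).1 (hbot ▸ (show q ∈ LinearMap.ker X.mulVecLin from hq)))

lemma continuous_W (M : StateSpace n m) : Continuous M.W := by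
  unfold W
  fun_prop

section Bounded

attribute [local instance] Matrix.normedAddCommGroup Matrix.normedSpace

/-- For a minimal model the solution set of the passivity inequality is compact. -/
theorem Minimal.isCompact_setOf_W_posSemidef {M : StateSpace n m} (hM : M.Minimal) :
    IsCompact {X : Matrix (Fin n) (Fin n) ℂ | X.PosSemidef ∧ (M.W X).PosSemidef} := by
  have hproper : ProperSpace (Matrix (Fin n) (Fin n) ℂ) := FiniteDimensional.proper ℝ _
  have hclosed : IsClosed {X : Matrix (Fin n) (Fin n) ℂ | X.PosSemidef ∧ (M.W X).PosSemidef} :=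
    isClosed_setOf_posSemidef.inter (isClosed_setOf_posSemidef.preimage M.continuous_W)
  refine Metric.isCompact_of_isClosed_isBounded hclosed ?_
  by_contra hunb
  have hseq : ∀ j : ℕ, ∃ X : Matrix (Fin n) (Fin n) ℂ,
      (X.PosSemidef ∧ (M.W X).PosSemidef) ∧ (j : ℝ) < ‖X‖ := by
    intro j
    by_contra! hc
    exact hunb (isBounded_iff_forall_norm_le.2 ⟨j, fun X hX => hc X hX⟩)
  choose X hX hXn using hseq
  have hXpos : ∀ j, 0 < ‖X j‖ := fun j => (Nat.cast_nonneg j).trans_lt (hXn j)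
  obtain ⟨Y, hY1, φ, hφ, hφY⟩ := (isCompact_sphere (0 : Matrix (Fin n) (Fin n) ℂ) 1).tendsto_subseq
    (x := fun j => ‖X j‖⁻¹ • X j) (fun j => by
      simp [norm_smul, (hXpos j).ne'])
  have hYpsd : Y.PosSemidef := isClosed_setOf_posSemidef.mem_of_tendsto hφY
    (Filter.Eventually.of_forall fun j => (hX _).1.smul (inv_nonneg.2 (hXpos _).le))
  -- The limit direction `Y` of an unbounded sequence satisfies the homogeneous inequality. Its zero
  -- lower right block forces `Y B = 0`, and controllability then gives `Y = 0`, against `‖Y‖ = 1`.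
  have hWlim : (M.W Y - M.W 0).PosSemidef := by
    have hinv : Filter.Tendsto (fun j => ‖X (φ j)‖⁻¹) Filter.atTop (nhds 0) := by
      refine Filter.Tendsto.inv_tendsto_atTop (Filter.tendsto_atTop_mono (fun j => (hXn (φ j)).le) ?_)
      exact tendsto_natCast_atTop_atTop.comp hφ.tendsto_atTop
    have h1 : Filter.Tendsto (fun j => M.W (‖X (φ j)‖⁻¹ • X (φ j)) - (1 - ‖X (φ j)‖⁻¹) • M.W 0)
        Filter.atTop (nhds (M.W Y - (1 - 0 : ℝ) • M.W 0)) :=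
      ((M.continuous_W.tendsto Y).comp hφY).sub ((hinv.const_sub 1).smul_const _)
    rw [sub_zero, one_smul] at h1
    refine isClosed_setOf_posSemidef.mem_of_tendsto h1 (Filter.Eventually.of_forall fun j => ?_)
    have h2 : ‖X (φ j)‖⁻¹ • X (φ j) = ‖X (φ j)‖⁻¹ • X (φ j) +
        (1 - ‖X (φ j)‖⁻¹) • (0 : Matrix (Fin n) (Fin n) ℂ) := by simp
    have h3 : M.W (‖X (φ j)‖⁻¹ • X (φ j)) - (1 - ‖X (φ j)‖⁻¹) • M.W 0 =
        ‖X (φ j)‖⁻¹ • M.W (X (φ j)) := by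
      conv_lhs => rw [h2]
      rw [W_combo M _ _ (by ring : ‖X (φ j)‖⁻¹ + (1 - ‖X (φ j)‖⁻¹) = 1), add_sub_cancel_right]
    change Matrix.PosSemidef _
    rw [h3]
    exact (hX _).2.smul (inv_nonneg.2 (hXpos _).le)
  have hblock : M.W Y - M.W 0 = fromBlocks (-(M.Aᴴ * Y) - Y * M.A) (-(Y * M.B)) (-(M.Bᴴ * Y)) 0 := by
    rw [W, W, sub_eq_add_neg, fromBlocks_neg, fromBlocks_add]
    congr 1 <;> simp <;> abel
  rw [hblock] at hWlim
  have htop := hM.1.eq_top (LinearMap.ker Y.mulVecLin)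
    (fun x hx => mulVec_mulVec_eq_zero_of_lyapunov hYpsd.1 (hWlim.submatrix Sum.inl) hx) (by
      intro u
      have h1 := congrArg (· ∘ Sum.inl) (hWlim.mulVec_eq_zero (v := Sum.elim 0 u) (by
        rw [reQuad, fromBlocks_mulVec]
        simp [dotProduct]))
      simpa [fromBlocks_mulVec, neg_mulVec, ← mulVec_mulVec] using h1)
  have hY0 : Y = 0 := by
    refine ext_of_mulVec_single fun i => ?_
    have : Pi.single i 1 ∈ LinearMap.ker Y.mulVecLin := htop ▸ Submodule.mem_top
    rw [zero_mulVec]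
    exact this
  simp [hY0] at hY1

end Bounded

end StateSpace

/-! ### Transfer functions: Markov parameters, poles and isomorphism of minimal realizations. -/

section Resolvent

open scoped Matrix.Norms.L2Operator

lemma Matrix.tendsto_inv_smul_one_sub {ι : Type*} [Fintype ι] [DecidableEq ι] (A : Matrix ι ι ℂ) :
    Tendsto (fun t : ℝ => ((t : ℂ) • (1 : Matrix ι ι ℂ) - A)⁻¹) atTop (𝓝 0) := by
  have : CompleteSpace (Matrix ι ι ℂ) := FiniteDimensional.complete ℂ _
  have h1 := spectrum.resolvent_tendsto_cobounded (𝕜 := ℂ) A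
  have h2 : Tendsto (fun t : ℝ => (t : ℂ)) atTop (Bornology.cobounded ℂ) := by
    rw [← tendsto_norm_atTop_iff_cobounded]
    simpa using tendsto_abs_atTop_atTop
  refine (h1.comp h2).congr fun t => ?_
  rw [Function.comp_apply, resolvent, nonsing_inv_eq_ringInverse, Algebra.algebraMap_eq_smul_one]

end Resolvent

namespace Matrix

variable {ι : Type*} [Fintype ι] [DecidableEq ι]

lemma eventually_notMem_spectrum (A : Matrix ι ι ℂ) : ∀ᶠ t : ℝ in atTop, (t : ℂ) ∉ spectrum ℂ A :=
  atTop_le_cofinite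
    (((finite_spectrum A).preimage Complex.ofReal_injective.injOn).compl_mem_cofinite)

lemma eventually_notMem_spectrum_punctured (A : Matrix ι ι ℂ) (z : ℂ) :
    ∀ᶠ s in 𝓝[≠] z, s ∉ spectrum ℂ A := by
  have h := ((finite_spectrum A).subset (Set.sdiff_subset (t := {z}))).isClosed.isOpen_compl.mem_nhds
    (x := z) (by simp)
  filter_upwards [mem_nhdsWithin_of_mem_nhds h, self_mem_nhdsWithin] with s hs hsz hmem
  exact hs ⟨hmem, hsz⟩

lemma continuousAt_inv_smul_one_sub {A : Matrix ι ι ℂ} {z : ℂ} (hz : z ∉ spectrum ℂ A) :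
    ContinuousAt (fun s : ℂ => (s • (1 : Matrix ι ι ℂ) - A)⁻¹) z := by
  have hc : Continuous fun s : ℂ => s • (1 : Matrix ι ι ℂ) - A := by fun_prop
  simp only [inv_def, Ring.inverse_eq_inv']
  exact ((hc.matrix_det.continuousAt).inv₀ (isUnit_det_smul_one_sub hz).ne_zero).smul
    hc.matrix_adjugate.continuousAt

lemma smul_inv_smul_one_sub {A : Matrix ι ι ℂ} {z : ℂ} (hz : z ∉ spectrum ℂ A) :
    z • (z • (1 : Matrix ι ι ℂ) - A)⁻¹ = 1 + A * (z • (1 : Matrix ι ι ℂ) - A)⁻¹ := by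
  have h := mul_nonsing_inv _ (isUnit_det_smul_one_sub hz)
  rw [Matrix.sub_mul, Matrix.smul_mul, Matrix.one_mul] at h
  exact sub_eq_iff_eq_add.1 h

end Matrix

namespace StateSpace

variable {n m k : ℕ} {M : StateSpace n m} {M' : StateSpace k m}

lemma tendsto_transfer (M : StateSpace n m) :
    Tendsto (fun t : ℝ => M.transfer t) atTop (𝓝 M.D) := by
  have h : Continuous fun R : Matrix (Fin n) (Fin n) ℂ => M.D + M.C * R * M.B := by fun_prop
  have h1 := (h.tendsto 0).comp (tendsto_inv_smul_one_sub M.A)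
  rw [Matrix.mul_zero, Matrix.zero_mul, add_zero] at h1
  exact h1

lemma SameTransfer.eventually_eq (h : M.SameTransfer M') :
    ∀ᶠ t : ℝ in atTop, M.transfer t = M'.transfer t := by
  filter_upwards [eventually_notMem_spectrum M.A, eventually_notMem_spectrum M'.A] with t h1 h2
  exact h t h1 h2

lemma SameTransfer.D_eq (h : M.SameTransfer M') : M.D = M'.D :=
  tendsto_nhds_unique (M.tendsto_transfer.congr' h.eventually_eq) M'.tendsto_transfer

/-- The Markov parameters are determined by the transfer function. -/
lemma SameTransfer.markov_eq (h : M.SameTransfer M') (i : ℕ) :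
    M.C * M.A ^ i * M.B = M'.C * M'.A ^ i * M'.B := by
  let f : ∀ {l : ℕ}, StateSpace l m → ℕ → ℝ → Matrix (Fin m) (Fin m) ℂ := fun {l} N i t =>
    N.C * N.A ^ i * ((t : ℂ) • (1 : Matrix (Fin l) (Fin l) ℂ) - N.A)⁻¹ * N.B
  -- Multiplication by `t` peels off one Markov parameter and leaves a remainder that tends to zero.
  have hstep : ∀ {l : ℕ} (N : StateSpace l m) (i : ℕ),
      ∀ᶠ t : ℝ in atTop, (t : ℂ) • f N i t = N.C * N.A ^ i * N.B + f N (i + 1) t := by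
    intro l N i
    filter_upwards [eventually_notMem_spectrum N.A] with t ht
    simp only [f]
    rw [← Matrix.smul_mul, ← Matrix.mul_smul, smul_inv_smul_one_sub ht, Matrix.mul_add,
      Matrix.mul_one, Matrix.add_mul, pow_succ]
    simp only [Matrix.mul_assoc]
  have hlim : ∀ {l : ℕ} (N : StateSpace l m) (i : ℕ), Tendsto (f N i) atTop (𝓝 0) := by
    intro l N i
    have hc : Continuous fun R : Matrix (Fin l) (Fin l) ℂ => N.C * N.A ^ i * R * N.B := by fun_prop
    have h1 := (hc.tendsto 0).comp (tendsto_inv_smul_one_sub N.A)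
    rw [Matrix.mul_zero, Matrix.zero_mul] at h1
    exact h1
  have hmark : ∀ i, (∀ᶠ t in atTop, f M i t = f M' i t) →
      M.C * M.A ^ i * M.B = M'.C * M'.A ^ i * M'.B := by
    intro i hi
    have h1 : Tendsto (fun t => M.C * M.A ^ i * M.B + f M (i + 1) t) atTop
        (𝓝 (M.C * M.A ^ i * M.B + 0)) := (hlim M (i + 1)).const_add _
    have h2 : Tendsto (fun t => M'.C * M'.A ^ i * M'.B + f M' (i + 1) t) atTop
        (𝓝 (M'.C * M'.A ^ i * M'.B + 0)) := (hlim M' (i + 1)).const_add _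
    rw [add_zero] at h1 h2
    refine tendsto_nhds_unique (h1.congr' ?_) h2
    filter_upwards [hi, hstep M i, hstep M' i] with t h3 h4 h5
    rw [← h4, ← h5, h3]
  have hf : ∀ i, ∀ᶠ t in atTop, f M i t = f M' i t := by
    intro i
    induction i with
    | zero =>
      filter_upwards [h.eventually_eq] with t ht
      rw [transfer, transfer, h.D_eq] at ht
      simpa [f] using ht
    | succ i ih =>
      filter_upwards [ih, hstep M i, hstep M' i] with t h3 h4 h5
      rw [h3, h5, hmark i ih] at h4
      exact (add_left_cancel h4).symm
  exact hmark i (hf i)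

/-- Every eigenvalue of a minimal realization is a pole, hence an eigenvalue of each realization. -/
theorem SameTransfer.spectrum_subset (hM : M.Minimal) (h : M.SameTransfer M') :
    spectrum ℂ M.A ⊆ spectrum ℂ M'.A := by
  intro z hz
  by_contra hz'
  obtain ⟨P, Q, hPQ⟩ := hM.1.exists_right_inverse z
  obtain ⟨P', Q', hPQ'⟩ := exists_left_inverse_of_controllable hM.2 z
  -- Off the two spectra this equals `(1 + (s - z)P')(s - A)⁻¹(1 + (s - z)P)`, but it is written
  -- with the other realization, hence continuous at `z`. Taking determinants and letting `s → z`
  -- gives `1 = 0`, since `det (z - A) = 0`.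
  let N : ℂ → Matrix (Fin n) (Fin n) ℂ := fun s =>
    P' * (1 + (s - z) • P) + Q' * M.C * P +
      Q' * (M'.C * (s • (1 : Matrix (Fin k) (Fin k) ℂ) - M'.A)⁻¹ * M'.B) * Q
  have hN : ContinuousAt N z := by
    have h1 := continuousAt_inv_smul_one_sub hz'
    have h2 : Continuous fun p : ℂ × Matrix (Fin k) (Fin k) ℂ =>
      P' * (1 + (p.1 - z) • P) + Q' * M.C * P + Q' * (M'.C * p.2 * M'.B) * Q := by fun_prop
    exact h2.continuousAt.comp (f := fun s : ℂ =>
      (s, (s • (1 : Matrix (Fin k) (Fin k) ℂ) - M'.A)⁻¹)) (continuousAt_id.prodMk h1)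
  have hL : Continuous fun s : ℂ => (1 + (s - z) • P').det * (1 + (s - z) • P).det := by fun_prop
  have hR : ContinuousAt (fun s : ℂ => (s • (1 : Matrix (Fin n) (Fin n) ℂ) - M.A).det * (N s).det) z :=
    (by fun_prop : Continuous fun s : ℂ => (s • (1 : Matrix (Fin n) (Fin n) ℂ) - M.A).det).continuousAt.mul
      ((continuous_id.matrix_det.continuousAt).comp hN)
  have heq : ∀ᶠ s in 𝓝[≠] z, (1 + (s - z) • P').det * (1 + (s - z) • P).det =
      (s • (1 : Matrix (Fin n) (Fin n) ℂ) - M.A).det * (N s).det := by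
    filter_upwards [eventually_notMem_spectrum_punctured M.A z,
      eventually_notMem_spectrum_punctured M'.A z] with s hs hs'
    have hdet := isUnit_det_smul_one_sub hs
    have ht := h s hs hs'
    rw [transfer, transfer, h.D_eq] at ht
    have ht' := add_left_cancel ht
    set S := s • (1 : Matrix (Fin n) (Fin n) ℂ) - M.A with hS
    have hSz : S = (z • (1 : Matrix (Fin n) (Fin n) ℂ) - M.A) + (s - z) • 1 := by
      rw [hS]; module
    have hJ : S * P + M.B * Q = 1 + (s - z) • P := by
      rw [hSz, Matrix.add_mul, Matrix.smul_mul, Matrix.one_mul, add_right_comm, hPQ]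
    have hJ' : P' * S + Q' * M.C = 1 + (s - z) • P' := by
      rw [hSz, Matrix.mul_add, Matrix.mul_smul, Matrix.mul_one, add_right_comm, hPQ']
    have hNs : N s = (1 + (s - z) • P') * S⁻¹ * (1 + (s - z) • P) := by
      have h1 : (1 + (s - z) • P') * S⁻¹ = P' + Q' * M.C * S⁻¹ := by
        rw [← hJ', Matrix.add_mul, Matrix.mul_assoc, mul_nonsing_inv _ hdet, Matrix.mul_one]
      have h2 : S⁻¹ * (1 + (s - z) • P) = P + S⁻¹ * M.B * Q := by
        rw [← hJ, Matrix.mul_add, ← Matrix.mul_assoc, nonsing_inv_mul _ hdet, Matrix.one_mul,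
          ← Matrix.mul_assoc]
      simp only [N]
      rw [← ht', h1, Matrix.add_mul, Matrix.mul_assoc (Q' * M.C), h2, Matrix.mul_add]
      simp only [Matrix.mul_assoc, add_assoc, Matrix.mul_add (M.C), Matrix.mul_add Q']
    rw [hNs, det_mul, det_mul]
    have : S.det * S⁻¹.det = 1 := by rw [← det_mul, mul_nonsing_inv _ hdet, det_one]
    linear_combination (-(1 + (s - z) • P').det * (1 + (s - z) • P).det) * this
  have h1 := tendsto_nhds_unique ((hL.continuousAt (x := z)).tendsto.mono_left nhdsWithin_le_nhds |>.congr' heq)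
    (hR.tendsto.mono_left nhdsWithin_le_nhds)
  obtain ⟨q, hq0, hq⟩ := (mem_spectrum_iff_exists_mulVec _ _).1 hz
  have h0 : (z • (1 : Matrix (Fin n) (Fin n) ℂ) - M.A).det = 0 :=
    exists_mulVec_eq_zero_iff.1 ⟨q, hq0, by rw [sub_mulVec, smul_mulVec, one_mulVec, hq, sub_self]⟩
  simp [h0] at h1

lemma mem_spectrum_shift (M : StateSpace n m) (ξ : ℝ) (z : ℂ) :
    z ∈ spectrum ℂ (M.shift ξ).A ↔ z - ((ξ / 2 : ℝ) : ℂ) ∈ spectrum ℂ M.A := by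
  rw [mem_spectrum_iff_exists_mulVec, mem_spectrum_iff_exists_mulVec]
  refine exists_congr fun q => and_congr_right fun _ => ?_
  rw [shift, add_mulVec, smul_mulVec, one_mulVec, sub_smul, eq_sub_iff_add_eq]

lemma transfer_shift (M : StateSpace n m) (ξ : ℝ) (s : ℂ) :
    (M.shift ξ).transfer s = M.transfer (s - ((ξ / 2 : ℝ) : ℂ)) -
      ((ξ / 2 : ℝ) : ℂ) • (1 : Matrix (Fin m) (Fin m) ℂ) := by
  simp only [transfer, shift]
  rw [sub_smul, sub_sub, add_comm (((ξ / 2 : ℝ) : ℂ) • (1 : Matrix (Fin n) (Fin n) ℂ))]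
  abel

/-- Strict passivity of a shifted realization passes to the minimal realizations. -/
theorem SameTransfer.strictlyPassive_shift (hM : M.Minimal) (h : M.SameTransfer M') {ξ : ℝ}
    (hξ : (M'.shift ξ).StrictlyPassive) : (M.shift ξ).StrictlyPassive := by
  have hsub : ∀ z ∈ spectrum ℂ (M.shift ξ).A, z ∈ spectrum ℂ (M'.shift ξ).A := fun z hz =>
    (mem_spectrum_shift _ _ _).2 (h.spectrum_subset hM ((mem_spectrum_shift _ _ _).1 hz))
  refine ⟨fun z hz => hξ.1 z (hsub z hz), fun ω => ?_, ?_⟩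
  · have hn : Complex.I * ω ∉ spectrum ℂ (M'.shift ξ).A := fun hmem =>
      absurd (hξ.1 _ hmem) (by simp)
    have := hξ.2.1 ω
    rwa [transfer_shift, ← h _ (fun hmem => hn (hsub _ ((mem_spectrum_shift _ _ _).2 hmem)))
      (fun hmem => hn ((mem_spectrum_shift _ _ _).2 hmem)), ← transfer_shift] at this
  · have := hξ.2.2
    simp only [shift] at this ⊢
    rwa [h.D_eq]

/-- The state space isomorphism theorem. -/
theorem SameTransfer.exists_eq_transform (hM : M.Minimal) (hM' : M'.Minimal)
    (h : M.SameTransfer M') : ∃ (V : Matrix (Fin k) (Fin n) ℂ) (V' : Matrix (Fin n) (Fin k) ℂ),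
      V * V' = 1 ∧ V' * V = 1 ∧ M' = M.transform V V' := by
  -- Pairs of states reached by the same inputs. Controllability makes both projections onto,
  -- observability makes both fibres over zero trivial, so `R` is the graph of the isomorphism.
  let R : Submodule ℂ ((Fin n → ℂ) × (Fin k → ℂ)) := Submodule.span ℂ
    {p | ∃ (i : ℕ) (u : Fin m → ℂ), p = (M.A ^ i *ᵥ (M.B *ᵥ u), M'.A ^ i *ᵥ (M'.B *ᵥ u))}
  have hRA : ∀ p ∈ R, (M.A *ᵥ p.1, M'.A *ᵥ p.2) ∈ R := by
    have : R ≤ R.comap (M.A.mulVecLin.prodMap M'.A.mulVecLin) := by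
      refine Submodule.span_le.2 ?_
      rintro _ ⟨i, u, rfl⟩
      refine Submodule.subset_span ⟨i + 1, u, ?_⟩
      simp [pow_succ', mulVec_mulVec, Matrix.mul_assoc]
    exact fun p hp => this hp
  have hRC : ∀ p ∈ R, M.C *ᵥ p.1 = M'.C *ᵥ p.2 := by
    have : R ≤ LinearMap.eqLocus (M.C.mulVecLin ∘ₗ LinearMap.fst ℂ _ _)
        (M'.C.mulVecLin ∘ₗ LinearMap.snd ℂ _ _) := by
      refine Submodule.span_le.2 ?_
      rintro _ ⟨i, u, rfl⟩
      have := congrArg (· *ᵥ u) (h.markov_eq i)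
      simpa [LinearMap.mem_eqLocus, mulVec_mulVec, Matrix.mul_assoc] using this
    exact fun p hp => this hp
  have hRB : ∀ u, (M.B *ᵥ u, M'.B *ᵥ u) ∈ R := fun u =>
    Submodule.subset_span ⟨0, u, by simp⟩
  have hfst : R.map (LinearMap.fst ℂ _ _) = ⊤ := by
    refine hM.1.eq_top _ ?_ fun u => ⟨_, hRB u, rfl⟩
    rintro _ ⟨p, hp, rfl⟩
    exact ⟨_, hRA p hp, rfl⟩
  have hsnd : R.map (LinearMap.snd ℂ _ _) = ⊤ := by
    refine hM'.1.eq_top _ ?_ fun u => ⟨_, hRB u, rfl⟩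
    rintro _ ⟨p, hp, rfl⟩
    exact ⟨_, hRA p hp, rfl⟩
  have hinl : ∀ x, (x, (0 : Fin k → ℂ)) ∈ R → x = 0 := by
    have hb : R.comap (LinearMap.inl ℂ _ _) = ⊥ := by
      refine eq_bot_of_controllable hM.2 _ (fun x hx => ?_) fun x hx => ?_
      · simpa using hRA _ hx
      · simpa using hRC _ hx
    exact fun x hx => (Submodule.mem_bot ℂ).1 (hb ▸ (show x ∈ R.comap (LinearMap.inl ℂ _ _) from hx))
  have hinr : ∀ y, ((0 : Fin n → ℂ), y) ∈ R → y = 0 := by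
    have hb : R.comap (LinearMap.inr ℂ _ _) = ⊥ := by
      refine eq_bot_of_controllable hM'.2 _ (fun x hx => ?_) fun x hx => ?_
      · simpa using hRA _ hx
      · simpa using (hRC _ hx).symm
    exact fun x hx => (Submodule.mem_bot ℂ).1 (hb ▸ (show x ∈ R.comap (LinearMap.inr ℂ _ _) from hx))
  have hV : ∃ V : Matrix (Fin k) (Fin n) ℂ, ∀ x, (x, V *ᵥ x) ∈ R := by
    have hex : ∀ j : Fin n, ∃ y, ((Pi.single j 1 : Fin n → ℂ), y) ∈ R := by
      intro j
      obtain ⟨⟨x, y⟩, hp, hx⟩ := (hfst ▸ Submodule.mem_top :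
        (Pi.single j 1 : Fin n → ℂ) ∈ R.map (LinearMap.fst ℂ _ _))
      exact ⟨y, by rw [← hx]; exact hp⟩
    choose y hy using hex
    refine ⟨fun i j => y j i, fun x => ?_⟩
    have : (x, (fun i j => y j i : Matrix (Fin k) (Fin n) ℂ) *ᵥ x) =
        ∑ j, x j • ((Pi.single j 1 : Fin n → ℂ), y j) := by
      ext i
      · simp [Prod.fst_sum, Finset.sum_apply, Pi.single_apply]
      · simp [Prod.snd_sum, Finset.sum_apply, mulVec, dotProduct, mul_comm]
    rw [this]
    exact Submodule.sum_mem _ fun j _ => R.smul_mem _ (hy j)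
  have hV' : ∃ V' : Matrix (Fin n) (Fin k) ℂ, ∀ x, (V' *ᵥ x, x) ∈ R := by
    have hex : ∀ j : Fin k, ∃ y, (y, (Pi.single j 1 : Fin k → ℂ)) ∈ R := by
      intro j
      obtain ⟨⟨x, y⟩, hp, hx⟩ := (hsnd ▸ Submodule.mem_top :
        (Pi.single j 1 : Fin k → ℂ) ∈ R.map (LinearMap.snd ℂ _ _))
      exact ⟨x, by rw [← hx]; exact hp⟩
    choose y hy using hex
    refine ⟨fun i j => y j i, fun x => ?_⟩
    have : ((fun i j => y j i : Matrix (Fin n) (Fin k) ℂ) *ᵥ x, x) =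
        ∑ j, x j • (y j, (Pi.single j 1 : Fin k → ℂ)) := by
      ext i
      · simp [Prod.fst_sum, Finset.sum_apply, mulVec, dotProduct, mul_comm]
      · simp [Prod.snd_sum, Finset.sum_apply, Pi.single_apply]
    rw [this]
    exact Submodule.sum_mem _ fun j _ => R.smul_mem _ (hy j)
  obtain ⟨V, hV⟩ := hV
  obtain ⟨V', hV'⟩ := hV'
  have huniq : ∀ x y y', (x, y) ∈ R → (x, y') ∈ R → y = y' := fun x y y' h1 h2 => by
    have := R.sub_mem h1 h2
    rw [Prod.mk_sub_mk, sub_self] at this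
    exact sub_eq_zero.1 (hinr _ this)
  have huniq' : ∀ x x' y, (x, y) ∈ R → (x', y) ∈ R → x = x' := fun x x' y h1 h2 => by
    have := R.sub_mem h1 h2
    rw [Prod.mk_sub_mk, sub_self] at this
    exact sub_eq_zero.1 (hinl _ this)
  have h1 : V * V' = 1 := ext_of_mulVec_single fun i => by
    rw [← mulVec_mulVec, one_mulVec]
    exact huniq _ _ _ (hV _) (hV' _)
  have h2 : V' * V = 1 := ext_of_mulVec_single fun i => by
    rw [← mulVec_mulVec, one_mulVec]
    exact huniq' _ _ _ (hV' _) (hV _)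
  have hA : V * M.A = M'.A * V := ext_of_mulVec_single fun i => by
    rw [← mulVec_mulVec, ← mulVec_mulVec]
    exact huniq _ _ _ (hV _) (hRA _ (hV _))
  have hB : V * M.B = M'.B := ext_of_mulVec_single fun i => by
    rw [← mulVec_mulVec]
    exact huniq _ _ _ (hV _) (hRB _)
  have hC : M.C = M'.C * V := ext_of_mulVec_single fun i => by
    rw [← mulVec_mulVec]
    exact hRC _ (hV _)
  refine ⟨V, V', h1, h2, ?_⟩
  rw [transform, hA, hB, hC, h.D_eq, Matrix.mul_assoc, Matrix.mul_assoc, h1, Matrix.mul_one,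
    Matrix.mul_one]


/-! ### The shifted inequality, the maximal shift and attainment of the radius. -/

/-- The weight `diag (X, I)`. -/
def blockWeight (X : Matrix (Fin n) (Fin n) ℂ) : Matrix (Fin n ⊕ Fin m) (Fin n ⊕ Fin m) ℂ :=
  fromBlocks X 0 0 1

lemma W_shift (M : StateSpace n m) (ξ : ℝ) (X : Matrix (Fin n) (Fin n) ℂ) :
    (M.shift ξ).W X = M.W X - ξ • blockWeight X := by
  have hξ : (ξ : ℂ) = ((ξ / 2 : ℝ) : ℂ) + ((ξ / 2 : ℝ) : ℂ) := by push_cast; ring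
  have hc : star ((ξ / 2 : ℝ) : ℂ) = ((ξ / 2 : ℝ) : ℂ) := Complex.conj_ofReal _
  have hs : ∀ {a b : Type} (N : Matrix a b ℂ), ξ • N = (ξ : ℂ) • N := fun N => by ext; simp
  rw [eq_sub_iff_add_eq, hs, W, W, blockWeight, fromBlocks_smul, fromBlocks_add]
  simp only [shift, conjTranspose_add, conjTranspose_sub, conjTranspose_smul, conjTranspose_one, hc,
    Matrix.add_mul, Matrix.mul_add, Matrix.smul_mul, Matrix.mul_smul, Matrix.one_mul,
    Matrix.mul_one, smul_zero, add_zero, hξ]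
  congr 1 <;> module

lemma shift_zero (M : StateSpace n m) : M.shift 0 = M := by
  ext1 <;> simp [shift]

lemma blockWeight_isHermitian {X : Matrix (Fin n) (Fin n) ℂ} (hX : X.IsHermitian) :
    (blockWeight X : Matrix (Fin n ⊕ Fin m) (Fin n ⊕ Fin m) ℂ).IsHermitian := by
  rw [blockWeight, IsHermitian, fromBlocks_conjTranspose, hX]
  simp

lemma reQuad_blockWeight (X : Matrix (Fin n) (Fin n) ℂ) (v : Fin n ⊕ Fin m → ℂ) :
    (blockWeight X : Matrix (Fin n ⊕ Fin m) (Fin n ⊕ Fin m) ℂ).reQuad v =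
      X.reQuad (v ∘ Sum.inl) + ‖WithLp.toLp 2 (v ∘ Sum.inr)‖ ^ 2 := by
  rw [← reQuad_one, reQuad, reQuad, reQuad, blockWeight, fromBlocks_mulVec]
  simp [dotProduct, Fintype.sum_sum_type]

lemma blockWeight_posSemidef {X : Matrix (Fin n) (Fin n) ℂ} (hX : X.PosSemidef) :
    (blockWeight X : Matrix (Fin n ⊕ Fin m) (Fin n ⊕ Fin m) ℂ).PosSemidef := by
  rw [(blockWeight_isHermitian hX.1).posSemidef_iff_reQuad]
  intro v
  rw [reQuad_blockWeight]
  exact add_nonneg (hX.reQuad_nonneg _) (sq_nonneg _)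

lemma blockWeight_posDef {X : Matrix (Fin n) (Fin n) ℂ} (hX : X.PosDef) :
    (blockWeight X : Matrix (Fin n ⊕ Fin m) (Fin n ⊕ Fin m) ℂ).PosDef := by
  refine (blockWeight_posSemidef hX.posSemidef).posDef_of_det_ne_zero ?_
  rw [blockWeight, det_fromBlocks_zero₂₁, det_one, mul_one]
  exact hX.det_pos.ne'

/-- Cauchy-Schwarz, as the sign in `diag(-X, I)` does not affect the norm. Equality at `X = I`
singles out the normalized coordinates. -/
lemma reQuad_blockWeight_le (X : Matrix (Fin n) (Fin n) ℂ) (v : Fin n ⊕ Fin m → ℂ) :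
    (blockWeight X : Matrix (Fin n ⊕ Fin m) (Fin n ⊕ Fin m) ℂ).reQuad v ≤
      ‖WithLp.toLp 2 ((weight X : Matrix (Fin n ⊕ Fin m) (Fin n ⊕ Fin m) ℂ) *ᵥ v)‖ *
        ‖WithLp.toLp 2 v‖ := by
  have h1 : ‖WithLp.toLp 2 ((weight X : Matrix (Fin n ⊕ Fin m) (Fin n ⊕ Fin m) ℂ) *ᵥ v)‖ =
      ‖WithLp.toLp 2 ((blockWeight X : Matrix (Fin n ⊕ Fin m) (Fin n ⊕ Fin m) ℂ) *ᵥ v)‖ := by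
    rw [weight_mulVec, blockWeight, fromBlocks_mulVec, EuclideanSpace.norm_eq,
      EuclideanSpace.norm_eq]
    simp
  rw [h1, mul_comm]
  exact (Complex.re_le_norm _).trans (norm_star_dotProduct_le _ _)

lemma norm_weight_one_mulVec (v : Fin n ⊕ Fin m → ℂ) :
    ‖WithLp.toLp 2 ((weight (1 : Matrix (Fin n) (Fin n) ℂ) :
      Matrix (Fin n ⊕ Fin m) (Fin n ⊕ Fin m) ℂ) *ᵥ v)‖ = ‖WithLp.toLp 2 v‖ := by
  rw [weight_mulVec, EuclideanSpace.norm_eq, EuclideanSpace.norm_eq]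
  simp

lemma W_shift_add (M : StateSpace n m) (ξ ξ' : ℝ) (X : Matrix (Fin n) (Fin n) ℂ) :
    (M.shift ξ').W X = (M.shift ξ).W X + (ξ - ξ') • blockWeight X := by
  rw [W_shift, W_shift]; module

lemma W_shift_posSemidef_of_le {M : StateSpace n m} {X : Matrix (Fin n) (Fin n) ℂ}
    (hX : X.PosSemidef) {ξ ξ' : ℝ} (h : ((M.shift ξ).W X).PosSemidef) (hle : ξ' ≤ ξ) :
    ((M.shift ξ').W X).PosSemidef := by
  rw [W_shift_add M ξ]
  exact h.add ((blockWeight_posSemidef hX).smul (sub_nonneg.2 hle))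

lemma W_shift_posDef_of_lt {M : StateSpace n m} {X : Matrix (Fin n) (Fin n) ℂ}
    (hX : X.PosDef) {ξ ξ' : ℝ} (h : ((M.shift ξ).W X).PosSemidef) (hlt : ξ' < ξ) :
    ((M.shift ξ').W X).PosDef := by
  rw [W_shift_add M ξ]
  exact PosDef.posSemidef_add h ((blockWeight_posDef hX).smul (sub_pos.2 hlt))

lemma W_posDef_of_W_shift {M : StateSpace n m} {X : Matrix (Fin n) (Fin n) ℂ}
    (hX : X.PosDef) {ξ : ℝ} (h : ((M.shift ξ).W X).PosSemidef) (hξ : 0 < ξ) : (M.W X).PosDef := by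
  have := W_shift_posDef_of_lt hX h hξ
  rwa [shift_zero] at this

lemma StrictlyPassive.shift_of_le {M : StateSpace n m} {ξ ξ' : ℝ}
    (h : (M.shift ξ).StrictlyPassive) (hle : ξ' ≤ ξ) : (M.shift ξ').StrictlyPassive := by
  obtain ⟨X, hX, hW⟩ := h.exists_W_posDef
  rcases hle.eq_or_lt with rfl | hlt
  · exact h
  · exact strictlyPassive_of_W_posDef hX (W_shift_posDef_of_lt hX hW.posSemidef hlt)

/-- A diagonal entry of `Dᴴ + D - ξ I` must stay positive; at least one input is needed for such an
entry. -/
lemma bddAbove_setOf_strictlyPassive_shift (hm : 0 < m) (M : StateSpace n m) :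
    BddAbove {ξ : ℝ | (M.shift ξ).StrictlyPassive} := by
  let i : Fin m := ⟨0, hm⟩
  refine ⟨((M.Dᴴ + M.D) i i).re, fun ξ hξ => ?_⟩
  have h1 := (Complex.lt_def.1 (hξ.2.2.diag_pos (i := i))).1
  simp [shift] at h1
  simp
  linarith

/-- A fixed certificate `X` with `W > 0` survives small shifts, by openness. -/
lemma StrictlyPassive.exists_pos_shift {M : StateSpace n m} (h : M.StrictlyPassive) :
    ∃ ξ : ℝ, 0 < ξ ∧ (M.shift ξ).StrictlyPassive := by
  obtain ⟨X, hX, hW⟩ := h.exists_W_posDef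
  have hc : Continuous fun ξ : ℝ => (M.shift ξ).W X := by
    simp only [W_shift]
    fun_prop
  have hopen := isOpen_setOf_reQuad_pos.preimage hc
  have h0 : (0 : ℝ) ∈ (fun ξ : ℝ => (M.shift ξ).W X) ⁻¹' {H | ∀ v, v ≠ 0 → 0 < H.reQuad v} := by
    intro v hv
    change 0 < ((M.shift 0).W X).reQuad v
    rw [shift_zero]
    exact hW.reQuad_pos hv
  obtain ⟨ε, hε, hball⟩ := Metric.isOpen_iff.1 hopen 0 h0
  have hmem : ε / 2 ∈ Metric.ball (0 : ℝ) ε := by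
    rw [Metric.mem_ball, Real.dist_eq, sub_zero, abs_of_pos (by positivity)]
    linarith
  exact ⟨ε / 2, by positivity, strictlyPassive_of_W_posDef hX
    (((M.shift _).W_isHermitian hX.1).posDef_iff_reQuad.2 (hball hmem))⟩

lemma isLUB_maxShift (hm : 0 < m) {M : StateSpace n m} (h : M.StrictlyPassive) :
    IsLUB {ξ : ℝ | (M.shift ξ).StrictlyPassive} M.maxShift :=
  isLUB_csSup ⟨0, by rwa [Set.mem_ofPred_eq, shift_zero]⟩ (bddAbove_setOf_strictlyPassive_shift hm M)

lemma maxShift_pos (hm : 0 < m) {M : StateSpace n m} (h : M.StrictlyPassive) : 0 < M.maxShift := by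
  obtain ⟨ξ, hξ, hs⟩ := h.exists_pos_shift
  exact hξ.trans_le ((isLUB_maxShift hm h).1 hs)

/-- No realization has a larger margin than half the maximal shift of a minimal one. -/
theorem SameTransfer.passivityMargin_le (hm : 0 < m) {M : StateSpace n m} {M' : StateSpace k m}
    (hM : M.Minimal) (hP : M.StrictlyPassive) (h : M.SameTransfer M') (ν : NormKind) :
    M'.passivityMargin ν ≤ ENNReal.ofReal (M.maxShift / 2) := by
  have hpos := maxShift_pos hm hP
  have hle : ∀ ξ, M.maxShift < ξ → M'.passivityMargin ν ≤ ENNReal.ofReal (ξ / 2) := fun ξ hξ =>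
    passivityMargin_le_of_not_strictlyPassive_shift ν M' (hpos.trans hξ).le fun hs =>
      absurd ((isLUB_maxShift hm hP).1 (h.strictlyPassive_shift hM hs)) (not_le.2 hξ)
  have htop : M'.passivityMargin ν ≠ ⊤ :=
    ne_top_of_le_ne_top ENNReal.ofReal_ne_top (hle (M.maxShift + 1) (by linarith))
  rw [← ENNReal.ofReal_toReal htop]
  refine ENNReal.ofReal_le_ofReal (le_of_forall_pos_le_add fun ε hε => ?_)
  have h1 := ENNReal.toReal_le_of_le_ofReal (by linarith) (hle (M.maxShift + 2 * ε) (by linarith))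
  linarith

lemma tendsto_mul_one_sub_one_div (a : ℝ) :
    Tendsto (fun j : ℕ => a * (1 - 1 / ((j : ℝ) + 1))) atTop (𝓝 a) := by
  simpa using ((tendsto_one_div_add_atTop_nhds_zero_nat (𝕜 := ℝ)).const_sub 1).const_mul a

lemma mul_one_sub_one_div_mono {a : ℝ} (ha : 0 ≤ a) (j : ℕ) :
    a * (1 - 1 / ((j : ℝ) + 1)) ≤ a * (1 - 1 / (((j + 1 : ℕ) : ℝ) + 1)) := by
  push_cast
  gcongr
  linarith

lemma mul_one_sub_one_div_lt {a : ℝ} (ha : 0 < a) (j : ℕ) : a * (1 - 1 / ((j : ℝ) + 1)) < a := by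
  have : 0 < 1 / ((j : ℝ) + 1) := by positivity
  nlinarith

lemma mul_one_sub_one_div_nonneg {a : ℝ} (ha : 0 ≤ a) (j : ℕ) :
    0 ≤ a * (1 - 1 / ((j : ℝ) + 1)) := by
  have : 1 / ((j : ℝ) + 1) ≤ 1 := by
    rw [div_le_one (by positivity)]
    linarith [Nat.cast_nonneg (α := ℝ) j]
  exact mul_nonneg ha (sub_nonneg.2 this)

/-- The inequality at the maximal shift has a positive definite solution. -/
theorem Minimal.exists_W_maxShift_posSemidef (hm : 0 < m) {M : StateSpace n m} (hM : M.Minimal)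
    (hP : M.StrictlyPassive) :
    ∃ X : Matrix (Fin n) (Fin n) ℂ, X.PosDef ∧ ((M.shift M.maxShift).W X).PosSemidef := by
  have hpos := maxShift_pos hm hP
  -- Starts at `0` and increases to the maximal shift, so the sets `K j` are nested, compact and
  -- nonempty; a common point solves the limiting inequality.
  set ξ : ℕ → ℝ := fun j => M.maxShift * (1 - 1 / ((j : ℝ) + 1)) with hξ
  let K : ℕ → Set (Matrix (Fin n) (Fin n) ℂ) := fun j =>
    {X | X.PosSemidef ∧ (M.W X).PosSemidef} ∩ {X | ((M.shift (ξ j)).W X).PosSemidef}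
  have hKc : ∀ j, IsClosed {X : Matrix (Fin n) (Fin n) ℂ | ((M.shift (ξ j)).W X).PosSemidef} :=
    fun j => isClosed_setOf_posSemidef.preimage (continuous_W _)
  obtain ⟨X, hX⟩ := IsCompact.nonempty_iInter_of_sequence_nonempty_isCompact_isClosed K
    (fun j X hX => ⟨hX.1, W_shift_posSemidef_of_le hX.1.1 hX.2
      (mul_one_sub_one_div_mono hpos.le j)⟩)
    (fun j => by
      obtain ⟨ζ, hζ, hlt⟩ := (lt_isLUB_iff (isLUB_maxShift hm hP)).1
        (mul_one_sub_one_div_lt hpos j)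
      obtain ⟨X, hX, hW⟩ := (StrictlyPassive.shift_of_le hζ hlt.le).exists_W_posDef
      refine ⟨X, ⟨hX.posSemidef, ?_⟩, hW.posSemidef⟩
      have := W_shift_posSemidef_of_le hX.posSemidef hW.posSemidef
        (mul_one_sub_one_div_nonneg hpos.le j)
      rwa [shift_zero] at this)
    (hM.isCompact_setOf_W_posSemidef.inter_right (hKc 0))
    (fun j => (hM.isCompact_setOf_W_posSemidef.inter_right (hKc j)).isClosed)
  rw [Set.mem_iInter] at hX
  refine ⟨X, posDef_of_W_posSemidef hM.2 (hX 0).1.1 (hX 0).1.2, ?_⟩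
  have hc : Continuous fun ξ : ℝ => (M.shift ξ).W X := by
    simp only [W_shift]
    fun_prop
  exact isClosed_setOf_posSemidef.mem_of_tendsto
    ((hc.tendsto _).comp (tendsto_mul_one_sub_one_div M.maxShift))
    (Eventually.of_forall fun j => (hX j).2)

lemma xPassivityRadius_le_passivityRadius (ν : NormKind) {M : StateSpace n m}
    {X : Matrix (Fin n) (Fin n) ℂ} (hX : X.PosDef) (hW : (M.W X).PosDef) :
    M.xPassivityRadius ν X ≤ M.passivityRadius ν :=
  le_iSup₂ (f := fun (X : Matrix (Fin n) (Fin n) ℂ) (_ : X.PosDef ∧ (M.W X).PosDef) =>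
    M.xPassivityRadius ν X) X ⟨hX, hW⟩

/-- A positive passivity radius of a minimal model is attained. -/
theorem Minimal.exists_xPassivityRadius_eq {M : StateSpace n m} (hM : M.Minimal) (ν : NormKind)
    {r : ℝ} (hr : 0 < r) (hρ : M.passivityRadius ν = ENNReal.ofReal r) :
    ∃ X : Matrix (Fin n) (Fin n) ℂ, X.PosDef ∧ (M.W X).PosDef ∧
      M.xPassivityRadius ν X = ENNReal.ofReal r := by
  let s : ℕ → ℝ := fun j => r * (1 - 1 / ((j : ℝ) + 1))
  let L : Matrix (Fin n) (Fin n) ℂ → (Fin n ⊕ Fin m → ℂ) → ℝ := fun X v =>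
    ‖WithLp.toLp 2 ((weight X : Matrix (Fin n ⊕ Fin m) (Fin n ⊕ Fin m) ℂ) *ᵥ v)‖ * ‖WithLp.toLp 2 v‖
  -- The radius condition is replaced by its quadratic form, which is closed in `X` and also makes
  -- sense for semidefinite `X`.
  let K : ℕ → Set (Matrix (Fin n) (Fin n) ℂ) := fun j =>
    {X | X.PosSemidef ∧ (M.W X).PosSemidef} ∩ {X | ∀ v, 2 * s j * L X v ≤ (M.W X).reQuad v}
  have hLc : ∀ v, Continuous fun X => L X v := by
    intro v
    have h1 : Continuous fun X : Matrix (Fin n) (Fin n) ℂ =>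
        (weight X : Matrix (Fin n ⊕ Fin m) (Fin n ⊕ Fin m) ℂ) *ᵥ v := by
      unfold weight
      fun_prop
    exact (((PiLp.continuous_toLp 2 _).comp h1).norm).mul continuous_const
  have hL0 : ∀ X v, 0 ≤ L X v := fun X v => by positivity
  have hKc : ∀ j, IsClosed {X : Matrix (Fin n) (Fin n) ℂ | ∀ v, 2 * s j * L X v ≤ (M.W X).reQuad v} := by
    intro j
    simp only [Set.ofPred_forall]
    exact isClosed_iInter fun v => isClosed_le ((hLc v).const_mul _)
      (continuous_reQuad.comp (M.continuous_W.prodMk continuous_const))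
  obtain ⟨X, hX⟩ := IsCompact.nonempty_iInter_of_sequence_nonempty_isCompact_isClosed K
    (fun j X hX => ⟨hX.1, fun v => le_trans (by
      have := mul_one_sub_one_div_mono hr.le j
      have := hL0 X v
      gcongr) (hX.2 v)⟩)
    (fun j => by
      have hlt : ENNReal.ofReal (s j) < M.passivityRadius ν := by
        rw [hρ]
        exact (ENNReal.ofReal_lt_ofReal_iff hr).2 (mul_one_sub_one_div_lt hr j)
      obtain ⟨X, hX⟩ := lt_iSup_iff.1 hlt
      obtain ⟨hX1, hX2⟩ := lt_iSup_iff.1 hX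
      exact ⟨X, ⟨hX1.1.posSemidef, hX1.2.posSemidef⟩, fun v =>
        le_reQuad_of_ofReal_le_xPassivityRadius ν hX1.1 hX1.2 hX2.le v⟩)
    (hM.isCompact_setOf_W_posSemidef.inter_right (hKc 0))
    (fun j => (hM.isCompact_setOf_W_posSemidef.inter_right (hKc j)).isClosed)
  rw [Set.mem_iInter] at hX
  have hXpd := posDef_of_W_posSemidef hM.2 (hX 0).1.1 (hX 0).1.2
  have hle : ∀ v, 2 * r * L X v ≤ (M.W X).reQuad v := fun v =>
    le_of_tendsto' (((tendsto_mul_one_sub_one_div r).const_mul 2).mul_const _) fun j => (hX j).2 v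
  have hWpd : (M.W X).PosDef := (M.W_isHermitian hXpd.1).posDef_iff_reQuad.2 fun v hv =>
    (mul_pos (by positivity) (mul_pos (norm_toLp_pos (weight_mulVec_ne_zero hXpd hv))
      (norm_toLp_pos hv))).trans_le (hle v)
  refine ⟨X, hXpd, hWpd, le_antisymm ?_ (ofReal_le_xPassivityRadius ν hXpd hle)⟩
  rw [← hρ]
  exact xPassivityRadius_le_passivityRadius ν hXpd hWpd

lemma W_shift_posSemidef_of_le_xPassivityRadius (ν : NormKind) {M : StateSpace n m}
    {X : Matrix (Fin n) (Fin n) ℂ} (hX : X.PosDef) (hW : (M.W X).PosDef) {ξ : ℝ} (hξ : 0 ≤ ξ)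
    (h : ENNReal.ofReal (ξ / 2) ≤ M.xPassivityRadius ν X) : ((M.shift ξ).W X).PosSemidef := by
  rw [((M.shift ξ).W_isHermitian hX.1).posSemidef_iff_reQuad]
  intro v
  have h1 := le_reQuad_of_ofReal_le_xPassivityRadius ν hX hW h v
  have h2 := mul_le_mul_of_nonneg_left (reQuad_blockWeight_le X v) hξ
  rw [W_shift, reQuad_sub, reQuad_smul]
  rw [mul_div_cancel₀ ξ two_ne_zero] at h1
  linarith

lemma le_xPassivityRadius_one (ν : NormKind) {M : StateSpace n m} {ξ : ℝ}
    (h : ((M.shift ξ).W 1).PosSemidef) : ENNReal.ofReal (ξ / 2) ≤ M.xPassivityRadius ν 1 := by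
  refine ofReal_le_xPassivityRadius ν PosDef.one fun v => ?_
  have h1 := h.reQuad_nonneg v
  rw [W_shift, reQuad_sub, reQuad_smul, blockWeight, fromBlocks_one, reQuad_one] at h1
  rw [norm_weight_one_mulVec, mul_div_cancel₀ ξ two_ne_zero]
  linarith

/-! ### Change of state coordinates. -/

section Transform

variable {V : Matrix (Fin k) (Fin n) ℂ} {V' : Matrix (Fin n) (Fin k) ℂ}

/-- The stored energy does not depend on coordinates, so `W` changes by congruence and keeps its
sign. -/
lemma W_transform (M : StateSpace n m) (h : V' * V = 1) (X : Matrix (Fin n) (Fin n) ℂ) :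
    (M.transform V V').W (V'ᴴ * X * V') =
      (fromBlocks V' 0 0 1 : Matrix (Fin n ⊕ Fin m) (Fin k ⊕ Fin m) ℂ)ᴴ * M.W X *
        (fromBlocks V' 0 0 1 : Matrix (Fin n ⊕ Fin m) (Fin k ⊕ Fin m) ℂ) := by
  have h' : Vᴴ * V'ᴴ = 1 := by rw [← conjTranspose_mul, h, conjTranspose_one]
  have e1 : ∀ (N : Matrix (Fin n) (Fin k) ℂ), Vᴴ * (V'ᴴ * N) = N := fun N => by
    rw [← Matrix.mul_assoc, h', Matrix.one_mul]
  have e2 : ∀ {l : ℕ} (N : Matrix (Fin n) (Fin l) ℂ), V' * (V * N) = N := fun N => by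
    rw [← Matrix.mul_assoc, h, Matrix.one_mul]
  simp only [W, transform, fromBlocks_conjTranspose, fromBlocks_multiply, conjTranspose_mul,
    conjTranspose_zero, conjTranspose_one, Matrix.zero_mul, Matrix.mul_zero, add_zero, zero_add,
    Matrix.one_mul, Matrix.mul_one, Matrix.mul_assoc, Matrix.mul_sub, Matrix.sub_mul,
    Matrix.mul_neg, Matrix.neg_mul, sub_zero, neg_zero, e1, e2]

lemma W_transform_posSemidef {M : StateSpace n m} (h : V' * V = 1) {X : Matrix (Fin n) (Fin n) ℂ}
    (hW : (M.W X).PosSemidef) : ((M.transform V V').W (V'ᴴ * X * V')).PosSemidef := by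
  rw [W_transform M h]
  exact hW.conjTranspose_mul_mul_same _

lemma mulVec_injective_of_mul_eq_one {ι κ : Type*} [Fintype ι] [Fintype κ] [DecidableEq κ]
    {P : Matrix κ ι ℂ} {Q : Matrix ι κ ℂ} (h : P * Q = 1) : Function.Injective Q.mulVec :=
  fun x y hxy => by
    rw [← one_mulVec x, ← one_mulVec y, ← h, ← mulVec_mulVec, ← mulVec_mulVec, hxy]

lemma W_transform_posDef {M : StateSpace n m} (h : V' * V = 1) (h' : V * V' = 1)
    {X : Matrix (Fin n) (Fin n) ℂ} (hW : (M.W X).PosDef) :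
    ((M.transform V V').W (V'ᴴ * X * V')).PosDef := by
  rw [W_transform M h]
  refine hW.conjTranspose_mul_mul_same (mulVec_injective_of_mul_eq_one
    (P := fromBlocks V 0 0 1) ?_)
  simp [fromBlocks_multiply, h']

lemma transform_transform (M : StateSpace n m) (h : V' * V = 1) :
    (M.transform V V').transform V' V = M := by
  have e : ∀ {l : ℕ} (N : Matrix (Fin n) (Fin l) ℂ), V' * (V * N) = N := fun N => by
    rw [← Matrix.mul_assoc, h, Matrix.one_mul]
  ext1 <;> simp [transform, Matrix.mul_assoc, e, h]

lemma transform_shift (M : StateSpace n m) (h' : V * V' = 1) (ξ : ℝ) :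
    (M.transform V V').shift ξ = (M.shift ξ).transform V V' := by
  ext1 <;> simp [transform, shift, Matrix.mul_add, Matrix.add_mul, h']

lemma conj_conj (h : V' * V = 1) (X : Matrix (Fin n) (Fin n) ℂ) :
    Vᴴ * (V'ᴴ * X * V') * V = X := by
  have h' : Vᴴ * V'ᴴ = 1 := by rw [← conjTranspose_mul, h, conjTranspose_one]
  rw [← Matrix.mul_assoc, ← Matrix.mul_assoc, h', Matrix.one_mul, Matrix.mul_assoc, h,
    Matrix.mul_one]

lemma sameTransfer_transform (M : StateSpace n m) (h : V' * V = 1) (h' : V * V' = 1) :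
    M.SameTransfer (M.transform V V') := by
  intro s hs _
  have hdet := isUnit_det_smul_one_sub hs
  set R := s • (1 : Matrix (Fin n) (Fin n) ℂ) - M.A with hR
  have hfac : s • (1 : Matrix (Fin k) (Fin k) ℂ) - V * M.A * V' = V * R * V' := by
    rw [hR, Matrix.mul_sub, Matrix.sub_mul, Matrix.mul_smul, Matrix.mul_one, Matrix.smul_mul, h']
  have e : ∀ {l : ℕ} (N : Matrix (Fin n) (Fin l) ℂ), V' * (V * N) = N := fun N => by
    rw [← Matrix.mul_assoc, h, Matrix.one_mul]
  have hinv : (s • (1 : Matrix (Fin k) (Fin k) ℂ) - V * M.A * V')⁻¹ = V * R⁻¹ * V' := by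
    refine inv_eq_right_inv ?_
    rw [hfac]
    simp only [Matrix.mul_assoc, e]
    rw [← Matrix.mul_assoc R, mul_nonsing_inv _ hdet, Matrix.one_mul, h']
  simp only [transfer, transform]
  rw [hinv, ← hR]
  simp only [Matrix.mul_assoc, e]

end Transform

/-! ### Port-Hamiltonian form and the optimal realizations. -/

/-- A model that satisfies the passivity inequality with `X = I` is port-Hamiltonian. -/
theorem isPortHamiltonian_one {M : StateSpace n m} (h : (M.W 1).PosSemidef) :
    M.IsPortHamiltonian 1 := by
  have hs : star (1 / 2 : ℂ) = 1 / 2 := by simp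
  -- Skew-Hermitian and Hermitian parts of `[A B; -C -D]` up to signs, arranged so that `[R K; Kᴴ
  -- S]` is `W(I) / 2`.
  refine ⟨PosDef.one, (1 / 2 : ℂ) • (M.A - M.Aᴴ), (1 / 2 : ℂ) • (-M.A - M.Aᴴ),
    (1 / 2 : ℂ) • (M.B + M.Cᴴ), (1 / 2 : ℂ) • (M.Cᴴ - M.B), (1 / 2 : ℂ) • (M.D + M.Dᴴ),
    (1 / 2 : ℂ) • (M.D - M.Dᴴ), ?_, ?_, ?_, ?_, ?_, ?_⟩
  · rw [Matrix.mul_one]; module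
  · module
  · have : (1 / 2 : ℂ) • (M.B + M.Cᴴ) + (1 / 2 : ℂ) • (M.Cᴴ - M.B) = M.Cᴴ := by module
    rw [this, conjTranspose_conjTranspose, Matrix.mul_one]
  · module
  · rw [fromBlocks_conjTranspose, fromBlocks_neg]
    simp only [conjTranspose_smul, conjTranspose_sub, conjTranspose_add, conjTranspose_neg,
      conjTranspose_conjTranspose, hs]
    congr 1 <;> module
  · have h1 := h.smul (a := (1 / 2 : ℂ)) (by rw [← hs]; norm_num [Complex.le_def])
    convert h1 using 1
    rw [W, fromBlocks_smul]
    simp only [conjTranspose_smul, conjTranspose_sub, conjTranspose_conjTranspose, hs,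
      Matrix.mul_one, Matrix.one_mul]
    congr 1 <;> module


lemma posDef_conjTranspose_mul_self_of_isUnit {T : Matrix (Fin n) (Fin n) ℂ} (hT : IsUnit T) :
    (Tᴴ * T).PosDef :=
  PosDef.conjTranspose_mul_self T (mulVec_injective_iff_isUnit.2 hT)

lemma conj_inv_gram {T : Matrix (Fin n) (Fin n) ℂ} (hT : IsUnit T) :
    T⁻¹ᴴ * (Tᴴ * T) * T⁻¹ = 1 := by
  have := conj_conj (V := T⁻¹) (V' := T) (mul_nonsing_inv T ((isUnit_iff_isUnit_det T).1 hT)) 1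
  rwa [Matrix.mul_one] at this

/-- A factored solution of the inequality at the maximal shift gives an optimal realization. -/
theorem transform_optimal (hm : 0 < m) {M : StateSpace n m} (hM : M.Minimal)
    (hP : M.StrictlyPassive) (ν : NormKind) {T : Matrix (Fin n) (Fin n) ℂ} (hT : IsUnit T)
    (h : ((M.shift M.maxShift).W (Tᴴ * T)).PosSemidef) :
    (M.W (Tᴴ * T)).PosDef ∧
      M.SameTransfer (M.transform T T⁻¹) ∧
      (M.transform T T⁻¹).IsPortHamiltonian 1 ∧
      (M.transform T T⁻¹).xPassivityRadius ν 1 = ENNReal.ofReal (M.maxShift / 2) ∧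
      (M.transform T T⁻¹).passivityRadius ν = ENNReal.ofReal (M.maxShift / 2) ∧
      (M.transform T T⁻¹).passivityMargin ν = ENNReal.ofReal (M.maxShift / 2) := by
  have hdet := (isUnit_iff_isUnit_det T).1 hT
  have h1 := nonsing_inv_mul T hdet
  have h2 := mul_nonsing_inv T hdet
  have hX := posDef_conjTranspose_mul_self_of_isUnit hT
  have hW := W_posDef_of_W_shift hX h (maxShift_pos hm hP)
  have hW' := W_transform_posDef h1 h2 hW
  have hs := W_transform_posSemidef h1 h
  rw [conj_inv_gram hT] at hW' hs
  rw [← transform_shift M h2] at hs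
  have hsame := sameTransfer_transform M h1 h2
  -- The four facts form the cycle `Ξ/2 ≤ ρ(I) ≤ ρ ≤ δ ≤ Ξ/2`.
  have ha := le_xPassivityRadius_one ν hs
  have hb := xPassivityRadius_le_passivityRadius ν PosDef.one hW'
  have hc := passivityRadius_le_passivityMargin ν (M.transform T T⁻¹)
  have hd := hsame.passivityMargin_le hm hM hP ν
  exact ⟨hW, hsame, isPortHamiltonian_one hW'.posSemidef,
    le_antisymm (hb.trans (hc.trans hd)) ha, le_antisymm (hc.trans hd) (ha.trans hb),
    le_antisymm hd (ha.trans (hb.trans hc))⟩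

lemma W_shift_posSemidef_of_transform {M : StateSpace n m} {V : Matrix (Fin k) (Fin n) ℂ}
    {V' : Matrix (Fin n) (Fin k) ℂ} (h : V' * V = 1) (h' : V * V' = 1) {ξ : ℝ}
    {X : Matrix (Fin n) (Fin n) ℂ}
    (hW : (((M.transform V V').shift ξ).W (V'ᴴ * X * V')).PosSemidef) :
    ((M.shift ξ).W X).PosSemidef := by
  have := W_transform_posSemidef h' hW
  rwa [transform_shift M h', transform_transform _ h, conj_conj h] at this

end StateSpace

open StateSpace

theorem mainTheorem1 {n m : ℕ} (hm : 0 < m) (M : StateSpace n m)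
    (hmin : M.Minimal) (hpass : M.StrictlyPassive) (ν : NormKind) :
    -- the supremum defining `Ξ` is finite, and positive
    IsLUB {ξ : ℝ | (M.shift ξ).StrictlyPassive} M.maxShift ∧
    0 < M.maxShift ∧
    -- `Ξ / 2` is the largest passivity radius over all realizations, of any state dimension
    IsGreatest {r : ℝ≥0∞ | ∃ (k : ℕ) (M' : StateSpace k m),
        M.SameTransfer M' ∧ M'.passivityRadius ν = r}
      (ENNReal.ofReal (M.maxShift / 2)) ∧
    -- the same for the smallest perturbation that destroys strict passivity
    IsGreatest {r : ℝ≥0∞ | ∃ (k : ℕ) (M' : StateSpace k m),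
        M.SameTransfer M' ∧ M'.passivityMargin ν = r}
      (ENNReal.ofReal (M.maxShift / 2)) ∧
    -- the inequality `W(X, M_Ξ) ≥ 0` has a solution `X > 0`
    (∃ X : Matrix (Fin n) (Fin n) ℂ, X.PosDef ∧ ((M.shift M.maxShift).W X).PosSemidef) ∧
    -- each factored solution `X = Tᴴ T` gives an optimal normalized port-Hamiltonian realization
    (∀ T : Matrix (Fin n) (Fin n) ℂ, IsUnit T →
      ((M.shift M.maxShift).W (Tᴴ * T)).PosSemidef →
        (M.W (Tᴴ * T)).PosDef ∧
        M.SameTransfer (M.transform T T⁻¹) ∧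
        (M.transform T T⁻¹).IsPortHamiltonian 1 ∧
        (M.transform T T⁻¹).xPassivityRadius ν 1 = ENNReal.ofReal (M.maxShift / 2) ∧
        (M.transform T T⁻¹).passivityRadius ν = ENNReal.ofReal (M.maxShift / 2) ∧
        (M.transform T T⁻¹).passivityMargin ν = ENNReal.ofReal (M.maxShift / 2)) ∧
    -- and only these `X` have port-Hamiltonian realizations whose `I`-passivity radius is optimal
    (∀ T : Matrix (Fin n) (Fin n) ℂ, IsUnit T → (M.W (Tᴴ * T)).PosDef →
      (M.transform T T⁻¹).xPassivityRadius ν 1 = ENNReal.ofReal (M.maxShift / 2) →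
        ((M.shift M.maxShift).W (Tᴴ * T)).PosSemidef) ∧
    -- the minimal realizations with optimal passivity radius are those coming from a solution `X`
    (∀ (k : ℕ) (M' : StateSpace k m), M'.Minimal → M.SameTransfer M' →
      (M'.passivityRadius ν = ENNReal.ofReal (M.maxShift / 2) ↔
        ∃ (V : Matrix (Fin k) (Fin n) ℂ) (V' : Matrix (Fin n) (Fin k) ℂ)
          (X : Matrix (Fin n) (Fin n) ℂ),
          V * V' = 1 ∧ V' * V = 1 ∧ M' = M.transform V V' ∧
          X.PosDef ∧ ((M.shift M.maxShift).W X).PosSemidef ∧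
          M'.xPassivityRadius ν (V'ᴴ * X * V') = ENNReal.ofReal (M.maxShift / 2))) := by
  have hpos := maxShift_pos hm hpass
  obtain ⟨X, hX, hXs⟩ := hmin.exists_W_maxShift_posSemidef hm hpass
  obtain ⟨T, hT, rfl⟩ : ∃ T : Matrix (Fin n) (Fin n) ℂ, IsUnit T ∧ X = Tᴴ * T := by
    obtain ⟨T, rfl⟩ := hX.posSemidef.exists_eq_conjTranspose_mul_self
    refine ⟨T, ?_, rfl⟩
    rw [isUnit_iff_isUnit_det, isUnit_iff_ne_zero]
    intro h0
    exact hX.det_pos.ne' (by rw [det_mul, h0, mul_zero])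
  obtain ⟨-, hsame, -, -, hρ, hδ⟩ := transform_optimal hm hmin hpass ν hT hXs
  refine ⟨isLUB_maxShift hm hpass, hpos, ⟨⟨n, _, hsame, hρ⟩, ?_⟩, ⟨⟨n, _, hsame, hδ⟩, ?_⟩,
    ⟨_, hX, hXs⟩, fun T hT h => transform_optimal hm hmin hpass ν hT h, fun T hT hW hr => ?_,
    fun k M' hM' hsame' => ⟨fun hr => ?_, ?_⟩⟩
  · rintro _ ⟨k, M', hM', rfl⟩
    exact (passivityRadius_le_passivityMargin ν M').trans (hM'.passivityMargin_le hm hmin hpass ν)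
  · rintro _ ⟨k, M', hM', rfl⟩
    exact hM'.passivityMargin_le hm hmin hpass ν
  · have hdet := (isUnit_iff_isUnit_det T).1 hT
    have h1 := nonsing_inv_mul T hdet
    have h2 := mul_nonsing_inv T hdet
    have hW' := W_transform_posDef h1 h2 hW
    rw [conj_inv_gram hT] at hW'
    refine W_shift_posSemidef_of_transform h1 h2 ?_
    rw [conj_inv_gram hT]
    exact W_shift_posSemidef_of_le_xPassivityRadius ν PosDef.one hW' hpos.le hr.ge
  · obtain ⟨V, V', h1, h2, rfl⟩ := hsame'.exists_eq_transform hmin hM'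
    -- The optimal radius of `M'` is attained at some `Y`; pulled back to the coordinates of `M` it
    -- is the required solution.
    obtain ⟨Y, hY, hWY, hrY⟩ := hM'.exists_xPassivityRadius_eq ν (half_pos hpos) hr
    have hYV : V'ᴴ * (Vᴴ * Y * V) * V' = Y := conj_conj h1 Y
    refine ⟨V, V', Vᴴ * Y * V, h1, h2, rfl,
      hY.conjTranspose_mul_mul_same (mulVec_injective_of_mul_eq_one h2), ?_, ?_⟩
    · refine W_shift_posSemidef_of_transform h2 h1 ?_
      rw [hYV]
      exact W_shift_posSemidef_of_le_xPassivityRadius ν hY hWY hpos.le hrY.ge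
    · rw [hYV, hrY]
  · rintro ⟨V, V', X, h1, h2, rfl, hX, hXs, hr⟩
    refine le_antisymm ((passivityRadius_le_passivityMargin ν _).trans
      (hsame'.passivityMargin_le hm hmin hpass ν)) ?_
    rw [← hr]
    exact xPassivityRadius_le_passivityRadius ν
      (hX.conjTranspose_mul_mul_same (mulVec_injective_of_mul_eq_one h1))
      (W_transform_posDef h2 h1 (W_posDef_of_W_shift hX hXs hpos))
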